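/- All algebras are over $\mathbb C$, associative, not necessarily unital; $M(\cdot)$ denotes the multiplier algebra. A homomorphism $\gamma:P\to M(Q)$ is non-degenerate if $\gamma(P)Q=Q=Q\gamma(P)$ (linear spans); if $Q$ has a non-degenerate product, such a $\gamma$ extends uniquely to a homomorphism $M(P)\to M(Q)$, denoted by the same symbol. We use the Sweedler notation. Let $(A,\Delta)$ be an algebraic quantum group: a regular multiplier Hopf algebra (a non-degenerate algebra $A$ with a coassociative homomorphism $\Delta:A\to M(A\otimes A)$ for which the maps sending $a\otimes a'$ to $\Delta(a)(1\otimes a')$, $(a\otimes 1)\Delta(a')$, $\Delta(a)(a'\otimes 1)$ and $(1\otimes a)\Delta(a')$ are bijections from $A\otimes A$ to $A\otimes A$) with a fixed non-zero left integral $\varphi$, i.e. a linear functional with $(\iota\otimes\varphi)\Delta(a)=\varphi(a)1$ for all $a\in A$. Let $B=\widehat A=\{\varphi(\,\cdot\,c): c\in A\}$ be its dual, with pairing $\langle a,b\rangle=b(a)$, the product $\langle a,bb'\rangle=\langle\Delta(a),b\otimes b'\rangle$ and the actions $\langle b\triangleright a,b'\rangle=\langle a,b'b\rangle$ of $B$ on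 $A$ and $\langle a',a\triangleright b\rangle=\langle a'a,b\rangle$, $\langle a',b\triangleleft a\rangle=\langle aa',b\rangle$ of $A$ on $B$ and on the linear functionals on $A$. Pairings are extended to multipliers by $\langle y\triangleright x,n\rangle=\langle x,ny\rangle$. Let $AB$ be the Heisenberg algebra, i.e. the vector space $A\otimes B$ with the product $$(a\otimes b)(a'\otimes b')=\sum\langle a'_{(2)},b_{(1)}\rangle\,aa'_{(1)}\otimes b_{(2)}b'=\sum aa'_{(1)}\otimes(b\triangleleft a'_{(2)})b'.$$ **Proposition.** The algebras $B$ and $AB$ are non-degenerate. There is a unique homomorphism $\Delta:B\to M(B\otimes B)$ with $\langle a\otimes a',\Delta(b)\rangle=\langle aa',b\rangle$, a unique $V\in M(B\otimes A)$ with $\langle V,a\otimes b\rangle=\langle a,b\rangle$, and a unique pair of homomorphisms $j_A:A\to M(AB)$, $j_B:B\to M(AB)$ such that $j_A(a)(a'\otimes b')=aa'\otimes b'$ and $(a'\otimes b')j_B(b)=a'\otimes b'b$. The homomorphisms $j_A$ and $j_B$ are non-degenerate, and $j_A(a)j_B(b)=a\otimes b$. Identifying $A$ and $B$ with their images in $M(AB)$,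 we have, for all $a\in A$ and $b\in B$, $$\Delta(a)V=V(a\otimes 1)\ \text{ in } M(AB\otimes A)\qquad\text{and}\qquad V\Delta(b)=(1\otimes b)V\ \text{ in } M(B\otimes AB).$$ Moreover, each of these two families of identities is equivalent to the Heisenberg commutation relations: for every non-degenerate algebra $C$ and all non-degenerate homomorphisms $j_A:A\to M(C)$, $j_B:B\to M(C)$, the following are equivalent: 1. $(j_A\otimes\iota)(\Delta(a))\,(j_B\otimes\iota)(V)=(j_B\otimes\iota)(V)\,(j_A(a)\otimes 1)$ in $M(C\otimes A)$ for all $a\in A$; 2. $(\iota\otimes j_A)(V)\,(\iota\otimes j_B)(\Delta(b))=(1\otimes j_B(b))\,(\iota\otimes j_A)(V)$ in $M(B\otimes C)$ for all $b\in B$; 3. $j_B(b)j_A(a)=\sum\langle a_{(2)},b_{(1)}\rangle\,j_A(a_{(1)})j_B(b_{(2)})$ for all $a\in A$, $b\in B$, where both sides are multiplied by elements of $j_A(A)$ from the left and of $j_B(B)$ from the right. -/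

import Mathlib

open scoped TensorProduct

noncomputable section

namespace MultiplierHopf

universe u v w

section Algebras

variable (A : Type u) [NonUnitalRing A] [Module ℂ A] [IsScalarTower ℂ A A] [SMulCommClass ℂ A A]

/-- The product of `A` is non-degenerate. -/
def IsNondegenerate (A : Type u) [NonUnitalRing A] : Prop :=
  (∀ a : A, (∀ x : A, a * x = 0) → a = 0) ∧ (∀ a : A, (∀ x : A, x * a = 0) → a = 0)

/-- The multiplier algebra `M(A)`: pairs `(L, R)` of linear maps with `R(x) y = x L(y)`,
where `L(y)` is written `m y` and `R(x)` is written `x m`. Left parts compose in the usual order,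
right parts in the opposite order. -/
def multiplierAlgebra : Subalgebra ℂ (Module.End ℂ A × (Module.End ℂ A)ᵐᵒᵖ) where
  carrier := {m | ∀ x y : A, m.2.unop x * y = x * m.1 y}
  mul_mem' := by
    intro m n hm hn x y
    simp only [Set.mem_ofPred_eq] at hm hn
    simp [hm, hn]
  add_mem' := by
    intro m n hm hn x y
    simp only [Set.mem_ofPred_eq] at hm hn
    simp [hm, hn, add_mul, mul_add]
  algebraMap_mem' := by
    intro r x y
    simp [Prod.algebraMap_apply, Module.algebraMap_end_apply, MulOpposite.algebraMap_apply,
      smul_mul_assoc, mul_smul_comm]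

/-- The type of multipliers of `A`. -/
def Multiplier : Type u := multiplierAlgebra A

instance : Ring (Multiplier A) := inferInstanceAs (Ring (multiplierAlgebra A))

instance : Algebra ℂ (Multiplier A) := inferInstanceAs (Algebra ℂ (multiplierAlgebra A))

end Algebras

namespace Multiplier

variable {A : Type u} [NonUnitalRing A] [Module ℂ A] [IsScalarTower ℂ A A] [SMulCommClass ℂ A A]
variable {C : Type v} [NonUnitalRing C] [Module ℂ C] [IsScalarTower ℂ C C] [SMulCommClass ℂ C C]
variable {D : Type w} [NonUnitalRing D] [Module ℂ D] [IsScalarTower ℂ D D] [SMulCommClass ℂ D D]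

/-- The map `x ↦ m x`. -/
def left (m : Multiplier A) : A →ₗ[ℂ] A := m.1.1

/-- The map `x ↦ x m`. -/
def right (m : Multiplier A) : A →ₗ[ℂ] A := m.1.2.unop

theorem central (m : Multiplier A) (x y : A) : right m x * y = x * left m y := m.2 x y

/-- The multiplier with given left and right parts. -/
def mk (L R : A →ₗ[ℂ] A) (h : ∀ x y, R x * y = x * L y) : Multiplier A :=
  ⟨(L, MulOpposite.op R), h⟩

@[simp] theorem left_mk (L R : A →ₗ[ℂ] A) (h : ∀ x y, R x * y = x * L y) :
    left (mk L R h) = L := rfl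
@[simp] theorem right_mk (L R : A →ₗ[ℂ] A) (h : ∀ x y, R x * y = x * L y) :
    right (mk L R h) = R := rfl
@[simp] theorem left_mul (m n : Multiplier A) (x : A) : left (m * n) x = left m (left n x) := rfl
@[simp] theorem right_mul (m n : Multiplier A) (x : A) :
    right (m * n) x = right n (right m x) := rfl
@[simp] theorem left_one (x : A) : left (1 : Multiplier A) x = x := rfl
@[simp] theorem right_one (x : A) : right (1 : Multiplier A) x = x := rfl
@[simp] theorem left_add (m n : Multiplier A) : left (m + n) = left m + left n := rfl
@[simp] theorem right_add (m n : Multiplier A) : right (m + n) = right m + right n := rfl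
@[simp] theorem left_smul (r : ℂ) (m : Multiplier A) : left (r • m) = r • left m := rfl
@[simp] theorem right_smul (r : ℂ) (m : Multiplier A) : right (r • m) = r • right m := rfl

theorem ext' {m n : Multiplier A} (hl : ∀ x, left m x = left n x)
    (hr : ∀ x, right m x = right n x) : m = n := by
  apply Subtype.ext
  apply Prod.ext
  · exact LinearMap.ext hl
  · exact MulOpposite.unop_injective (LinearMap.ext hr)

/-- The canonical map `A → M(A)`. -/
def of (a : A) : Multiplier A :=
  mk (LinearMap.mulLeft ℂ a) (LinearMap.mulRight ℂ a) (by simp [mul_assoc])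

@[simp] theorem left_of (a x : A) : left (of a) x = a * x := rfl
@[simp] theorem right_of (a x : A) : right (of a) x = x * a := rfl

variable (A) in
/-- The canonical map `A → M(A)` as a homomorphism. -/
def ofHom : A →ₙₐ[ℂ] Multiplier A where
  toFun := of
  map_smul' r a := ext' (fun x => smul_mul_assoc r a x) (fun x => mul_smul_comm r x a)
  map_zero' := ext' (fun x => zero_mul x) (fun x => mul_zero x)
  map_add' a b := ext' (fun x => add_mul a b x) (fun x => mul_add x a b)
  map_mul' a b := ext' (fun x => mul_assoc a b x) (fun x => (mul_assoc x a b).symm)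

@[simp] theorem ofHom_apply (a : A) : ofHom A a = of a := rfl

theorem of_injective (hA : IsNondegenerate A) : Function.Injective (of : A → Multiplier A) := by
  intro a b h
  rw [← sub_eq_zero]
  apply hA.1
  intro x
  have := congrArg (fun m => left m x) h
  have h' : a * x = b * x := this
  rw [sub_mul, h', sub_self]

theorem left_mul_right (hA : IsNondegenerate A) (m : Multiplier A) (x y : A) :
    left m (x * y) = left m x * y := by
  rw [← sub_eq_zero]
  apply hA.2
  intro z
  rw [mul_sub, ← central, ← mul_assoc, ← mul_assoc, ← central, sub_self]

theorem right_mul_left (hA : IsNondegenerate A) (m : Multiplier A) (x y : A) :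
    right m (x * y) = x * right m y := by
  rw [← sub_eq_zero]
  apply hA.1
  intro z
  rw [sub_mul, central, mul_assoc, mul_assoc, central, sub_self]

theorem mul_of (hA : IsNondegenerate A) (m : Multiplier A) (x : A) : m * of x = of (left m x) :=
  ext' (fun y => by simp [left_mul_right hA]) (fun y => by simp [central])

theorem of_mul (hA : IsNondegenerate A) (m : Multiplier A) (x : A) : of x * m = of (right m x) :=
  ext' (fun y => by simp [central]) (fun y => by simp [right_mul_left hA])

theorem ext_left (hA : IsNondegenerate A) {m n : Multiplier A} (h : ∀ x, left m x = left n x) :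
    m = n := by
  refine ext' h fun x => ?_
  rw [← sub_eq_zero]
  apply hA.1
  intro y
  rw [sub_mul, central, central, h, sub_self]

/-- The element `m ⊗ n` of `M(C ⊗ D)` for `m` in `M(C)` and `n` in `M(D)`. -/
def tmul (m : Multiplier C) (n : Multiplier D) : Multiplier (C ⊗[ℂ] D) :=
  mk (TensorProduct.map (left m) (left n)) (TensorProduct.map (right m) (right n)) (by
    intro x y
    induction x with
    | zero => simp
    | add x₁ x₂ h₁ h₂ => simp [add_mul, h₁, h₂]
    | tmul c d =>
      induction y with
      | zero => simp
      | add y₁ y₂ h₁ h₂ => simp only [mul_add, map_add, h₁, h₂]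
      | tmul c' d' => simp [central])

@[simp] theorem left_tmul (m : Multiplier C) (n : Multiplier D) :
    left (tmul m n) = TensorProduct.map (left m) (left n) := rfl
@[simp] theorem right_tmul (m : Multiplier C) (n : Multiplier D) :
    right (tmul m n) = TensorProduct.map (right m) (right n) := rfl

theorem tmul_mul_tmul (m m' : Multiplier C) (n n' : Multiplier D) :
    tmul m n * tmul m' n' = tmul (m * m') (n * n') := by
  apply ext'
  · intro x
    induction x with
    | zero => simp
    | add x₁ x₂ h₁ h₂ => rw [map_add, map_add, h₁, h₂]
    | tmul c d => simp
  · intro x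
    induction x with
    | zero => simp
    | add x₁ x₂ h₁ h₂ => rw [map_add, map_add, h₁, h₂]
    | tmul c d => simp

theorem of_tmul (c : C) (d : D) : of (c ⊗ₜ[ℂ] d) = tmul (of c) (of d) := by
  apply ext'
  · intro x
    induction x with
    | zero => simp
    | add x₁ x₂ h₁ h₂ => rw [map_add, map_add, h₁, h₂]
    | tmul c d => simp
  · intro x
    induction x with
    | zero => simp
    | add x₁ x₂ h₁ h₂ => rw [map_add, map_add, h₁, h₂]
    | tmul c d => simp

/-- `m ⊗ n` as a bilinear map in `m` and `n`. -/
def tmulₗ : Multiplier C →ₗ[ℂ] Multiplier D →ₗ[ℂ] Multiplier (C ⊗[ℂ] D) :=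
  LinearMap.mk₂ ℂ tmul
    (fun m m' n => ext' (fun x => by simp [TensorProduct.map_add_left])
      (fun x => by simp [TensorProduct.map_add_left]))
    (fun r m n => ext' (fun x => by simp [TensorProduct.map_smul_left])
      (fun x => by simp [TensorProduct.map_smul_left]))
    (fun m n n' => ext' (fun x => by simp [TensorProduct.map_add_right])
      (fun x => by simp [TensorProduct.map_add_right]))
    (fun r m n => ext' (fun x => by simp [TensorProduct.map_smul_right])
      (fun x => by simp [TensorProduct.map_smul_right]))

end Multiplier

open Multiplier

section Extension

variable {P : Type u} [NonUnitalRing P] [Module ℂ P] [IsScalarTower ℂ P P] [SMulCommClass ℂ P P]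
variable {Q : Type v} [NonUnitalRing Q] [Module ℂ Q] [IsScalarTower ℂ Q Q] [SMulCommClass ℂ Q Q]

/-- A homomorphism `γ : P → M(Q)` is non-degenerate if `γ(P) Q = Q = Q γ(P)` (linear spans). -/
def IsNondegenerateHom (γ : P →ₙₐ[ℂ] Multiplier Q) : Prop :=
  Submodule.span ℂ {y : Q | ∃ p x, y = left (γ p) x} = ⊤ ∧
  Submodule.span ℂ {y : Q | ∃ p x, y = right (γ p) x} = ⊤

/-- `n ∈ M(Q)` is the image of `m ∈ M(P)` under the extension of `γ : P → M(Q)` to `M(P)`. -/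
def IsExtension (γ : P →ₙₐ[ℂ] Multiplier Q) (m : Multiplier P) (n : Multiplier Q) : Prop :=
  ∀ p : P, n * γ p = γ (left m p) ∧ γ p * n = γ (right m p)

theorem IsExtension.unique {γ : P →ₙₐ[ℂ] Multiplier Q} (hγ : IsNondegenerateHom γ)
    {m : Multiplier P} {n n' : Multiplier Q} (h : IsExtension γ m n) (h' : IsExtension γ m n') :
    n = n' := by
  apply ext'
  · have : left n = left n' := by
      refine LinearMap.ext_on hγ.1 ?_
      rintro _ ⟨p, x, rfl⟩
      rw [← left_mul, ← left_mul, (h p).1, (h' p).1]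
    simp [this]
  · have : right n = right n' := by
      refine LinearMap.ext_on hγ.2 ?_
      rintro _ ⟨p, x, rfl⟩
      rw [← right_mul, ← right_mul, (h p).2, (h' p).2]
    simp [this]

theorem exists_isExtension (hQ : IsNondegenerate Q) {γ : P →ₙₐ[ℂ] Multiplier Q}
    (hγ : IsNondegenerateHom γ) (m : Multiplier P) : ∃ n, IsExtension γ m n := by
  -- the two maps `P ⊗ Q → Q` and their twisted versions
  let actL : P ⊗[ℂ] Q →ₗ[ℂ] Q := TensorProduct.lift (LinearMap.mk₂ ℂ (fun p x => left (γ p) x)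
    (by simp) (by simp) (by simp) (by simp))
  let actR : P ⊗[ℂ] Q →ₗ[ℂ] Q := TensorProduct.lift (LinearMap.mk₂ ℂ (fun p x => right (γ p) x)
    (by simp) (by simp) (by simp) (by simp))
  have surjL : Function.Surjective actL := by
    rw [← LinearMap.range_eq_top, eq_top_iff, ← hγ.1, Submodule.span_le]
    rintro _ ⟨p, x, rfl⟩
    exact ⟨p ⊗ₜ x, by simp [actL]⟩
  have surjR : Function.Surjective actR := by
    rw [← LinearMap.range_eq_top, eq_top_iff, ← hγ.2, Submodule.span_le]
    rintro _ ⟨p, x, rfl⟩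
    exact ⟨p ⊗ₜ x, by simp [actR]⟩
  have key : ∀ s t, actR (TensorProduct.map (right m) LinearMap.id s) * actL t =
      actR s * actL (TensorProduct.map (left m) LinearMap.id t) := by
    intro s t
    induction s with
    | zero => simp
    | add s₁ s₂ h₁ h₂ => simp only [map_add, add_mul, h₁, h₂]
    | tmul p x =>
      induction t with
      | zero => simp
      | add t₁ t₂ h₁ h₂ => simp only [map_add, mul_add, h₁, h₂]
      | tmul q y =>
        simp only [TensorProduct.map_tmul, LinearMap.id_coe, id_eq, TensorProduct.lift.tmul,
          LinearMap.mk₂_apply, actR, actL]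
        rw [central, central, ← left_mul, ← left_mul, ← map_mul, ← map_mul, central]
  let gL := (LinearMap.ker actL).liftQ (actL ∘ₗ TensorProduct.map (left m) LinearMap.id) (by
    intro t ht
    rw [LinearMap.mem_ker] at ht ⊢
    apply hQ.2
    intro z
    obtain ⟨s, rfl⟩ := surjR z
    rw [LinearMap.comp_apply, ← key, ht, mul_zero])
  let gR := (LinearMap.ker actR).liftQ (actR ∘ₗ TensorProduct.map (right m) LinearMap.id) (by
    intro t ht
    rw [LinearMap.mem_ker] at ht ⊢
    apply hQ.1
    intro z
    obtain ⟨s, rfl⟩ := surjL z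
    rw [LinearMap.comp_apply, key, ht, zero_mul])
  let L : Q →ₗ[ℂ] Q := gL ∘ₗ (actL.quotKerEquivOfSurjective surjL).symm.toLinearMap
  let R : Q →ₗ[ℂ] Q := gR ∘ₗ (actR.quotKerEquivOfSurjective surjR).symm.toLinearMap
  have hL : ∀ t, L (actL t) = actL (TensorProduct.map (left m) LinearMap.id t) := by
    intro t
    have : (actL.quotKerEquivOfSurjective surjL).symm (actL t) = Submodule.Quotient.mk t := by
      rw [LinearEquiv.symm_apply_eq]; rfl
    simp only [L, LinearMap.comp_apply, LinearEquiv.coe_coe, this]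
    rfl
  have hR : ∀ t, R (actR t) = actR (TensorProduct.map (right m) LinearMap.id t) := by
    intro t
    have : (actR.quotKerEquivOfSurjective surjR).symm (actR t) = Submodule.Quotient.mk t := by
      rw [LinearEquiv.symm_apply_eq]; rfl
    simp only [R, LinearMap.comp_apply, LinearEquiv.coe_coe, this]
    rfl
  have hc : ∀ x y, R x * y = x * L y := by
    intro x y
    obtain ⟨s, rfl⟩ := surjR x
    obtain ⟨t, rfl⟩ := surjL y
    rw [hL, hR, key]
  refine ⟨mk L R hc, fun p => ⟨?_, ?_⟩⟩
  · refine ext_left hQ fun x => ?_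
    have := hL (p ⊗ₜ x)
    simpa [actL] using this
  · have hr : ∀ x, right (γ p * mk L R hc) x = right (γ (right m p)) x := fun x => by
      have := hR (p ⊗ₜ x)
      simpa [actR] using this
    refine ext_left hQ fun x => ?_
    rw [← sub_eq_zero]
    apply hQ.2
    intro z
    rw [mul_sub, ← central, ← central, hr, sub_self]

open Classical in
/-- The extension of `γ : P → M(Q)` to `M(P) → M(Q)`. For a non-degenerate homomorphism `γ` and a
non-degenerate algebra `Q`, it is the unique one, see `extend_spec`. -/
def extend (γ : P →ₙₐ[ℂ] Multiplier Q) (m : Multiplier P) : Multiplier Q :=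
  if h : ∃ n, IsExtension γ m n then h.choose else 0

theorem extend_spec (hQ : IsNondegenerate Q) {γ : P →ₙₐ[ℂ] Multiplier Q}
    (hγ : IsNondegenerateHom γ) (m : Multiplier P) : IsExtension γ m (extend γ m) := by
  have h := exists_isExtension hQ hγ m
  rw [extend, dif_pos h]
  exact h.choose_spec

end Extension

section TensorHom

variable {P : Type*} [NonUnitalRing P] [Module ℂ P] [IsScalarTower ℂ P P] [SMulCommClass ℂ P P]
variable {Q : Type*} [NonUnitalRing Q] [Module ℂ Q] [IsScalarTower ℂ Q Q] [SMulCommClass ℂ Q Q]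
variable {C : Type*} [NonUnitalRing C] [Module ℂ C] [IsScalarTower ℂ C C] [SMulCommClass ℂ C C]
variable {D : Type*} [NonUnitalRing D] [Module ℂ D] [IsScalarTower ℂ D D] [SMulCommClass ℂ D D]

/-- The homomorphism `α ⊗ β : P ⊗ Q → M(C ⊗ D)` for `α : P → M(C)` and `β : Q → M(D)`. -/
def tensorHom (α : P →ₙₐ[ℂ] Multiplier C) (β : Q →ₙₐ[ℂ] Multiplier D) :
    P ⊗[ℂ] Q →ₙₐ[ℂ] Multiplier (C ⊗[ℂ] D) :=
  { TensorProduct.lift (tmulₗ.compl₁₂ (α : P →ₗ[ℂ] Multiplier C) (β : Q →ₗ[ℂ] Multiplier D)) with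
    map_zero' := map_zero _
    map_mul' := by
      intro x y
      change TensorProduct.lift _ (x * y) = TensorProduct.lift _ x * TensorProduct.lift _ y
      induction x with
      | zero => simp
      | add x₁ x₂ h₁ h₂ => rw [add_mul, map_add, h₁, h₂, map_add, add_mul]
      | tmul c d =>
        induction y with
        | zero => simp
        | add y₁ y₂ h₁ h₂ => rw [mul_add, map_add, h₁, h₂, map_add, mul_add]
        | tmul c' d' => simp [tmulₗ, tmul_mul_tmul] }

@[simp] theorem tensorHom_tmul (α : P →ₙₐ[ℂ] Multiplier C) (β : Q →ₙₐ[ℂ] Multiplier D)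
    (p : P) (q : Q) : tensorHom α β (p ⊗ₜ q) = tmul (α p) (β q) := rfl

theorem tensorHom_nondegenerate {α : P →ₙₐ[ℂ] Multiplier C} {β : Q →ₙₐ[ℂ] Multiplier D}
    (hα : IsNondegenerateHom α) (hβ : IsNondegenerateHom β) :
    IsNondegenerateHom (tensorHom α β) := by
  have aux : ∀ (f : P → C → C) (g : Q → D → D) (S : Submodule ℂ (C ⊗[ℂ] D)),
      Submodule.span ℂ {y | ∃ p x, y = f p x} = ⊤ → Submodule.span ℂ {y | ∃ p x, y = g p x} = ⊤ →
      (∀ p q x y, f p x ⊗ₜ g q y ∈ S) → S = ⊤ := by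
    intro f g S hf hg h
    rw [eq_top_iff, ← TensorProduct.span_tmul_eq_top, Submodule.span_le]
    rintro _ ⟨c, d, rfl⟩
    have hc : c ∈ Submodule.span ℂ {y | ∃ p x, y = f p x} := hf ▸ Submodule.mem_top
    have hd : d ∈ Submodule.span ℂ {y | ∃ p x, y = g p x} := hg ▸ Submodule.mem_top
    induction hc using Submodule.span_induction with
    | zero => simp
    | add x y _ _ h₁ h₂ => rw [TensorProduct.add_tmul]; exact S.add_mem h₁ h₂
    | smul r x _ h₁ => rw [← TensorProduct.smul_tmul']; exact S.smul_mem r h₁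
    | mem x hx =>
      obtain ⟨p, x, rfl⟩ := hx
      induction hd using Submodule.span_induction with
      | zero => simp
      | add x y _ _ h₁ h₂ => rw [TensorProduct.tmul_add]; exact S.add_mem h₁ h₂
      | smul r x _ h₁ => rw [TensorProduct.tmul_smul]; exact S.smul_mem r h₁
      | mem y hy =>
        obtain ⟨q, y, rfl⟩ := hy
        exact h p q x y
  refine ⟨aux _ _ _ hα.1 hβ.1 ?_, aux _ _ _ hα.2 hβ.2 ?_⟩
  · intro p q x y
    exact Submodule.subset_span ⟨p ⊗ₜ q, x ⊗ₜ y, by simp⟩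
  · intro p q x y
    exact Submodule.subset_span ⟨p ⊗ₜ q, x ⊗ₜ y, by simp⟩

end TensorHom

/-- The slice map `ι ⊗ ω : X ⊗ Y → X` for a linear functional `ω` on `Y`. -/
def slice {X Y : Type*} [AddCommGroup X] [Module ℂ X] [AddCommGroup Y] [Module ℂ Y]
    (ω : Y →ₗ[ℂ] ℂ) : X ⊗[ℂ] Y →ₗ[ℂ] X :=
  (TensorProduct.rid ℂ X).toLinearMap ∘ₗ LinearMap.lTensor X ω

section Slice

variable {X Y : Type*} [AddCommGroup X] [Module ℂ X] [AddCommGroup Y] [Module ℂ Y]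

@[simp] theorem slice_tmul (ω : Y →ₗ[ℂ] ℂ) (x : X) (y : Y) : slice ω (x ⊗ₜ[ℂ] y) = ω y • x := by
  simp [slice]

theorem eq_zero_of_slice {t : X ⊗[ℂ] Y} (h : ∀ ω : Y →ₗ[ℂ] ℂ, slice ω t = 0) : t = 0 := by
  classical
  let b := Module.Basis.ofVectorSpace ℂ Y
  apply (TensorProduct.equivFinsuppOfBasisRight (M := X) b).injective
  ext i
  rw [TensorProduct.equivFinsuppOfBasisRight_apply]
  simpa [slice] using h (b.coord i)

theorem slice_map {X' Y' : Type*} [AddCommGroup X'] [Module ℂ X'] [AddCommGroup Y'] [Module ℂ Y']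
    (f : X →ₗ[ℂ] X') (g : Y →ₗ[ℂ] Y') (ω : Y' →ₗ[ℂ] ℂ) (t : X ⊗[ℂ] Y) :
    slice ω (TensorProduct.map f g t) = f (slice (ω ∘ₗ g) t) := by
  induction t with
  | zero => simp
  | add x y h₁ h₂ => simp [h₁, h₂]
  | tmul x y => simp

end Slice

theorem IsNondegenerate.tensor {C D : Type*}
    [NonUnitalRing C] [Module ℂ C] [IsScalarTower ℂ C C] [SMulCommClass ℂ C C]
    [NonUnitalRing D] [Module ℂ D] [IsScalarTower ℂ D D] [SMulCommClass ℂ D D]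
    (hC : IsNondegenerate C) (hD : IsNondegenerate D) : IsNondegenerate (C ⊗[ℂ] D) := by
  have aux : ∀ (f : C → C →ₗ[ℂ] C) (g : D → D →ₗ[ℂ] D), (∀ c, (∀ x, f x c = 0) → c = 0) →
      (∀ d, (∀ y, g y d = 0) → d = 0) → ∀ t : C ⊗[ℂ] D,
      (∀ x y, TensorProduct.map (f x) (g y) t = 0) → t = 0 := by
    intro f g hf hg t ht
    have h1 : ∀ y, TensorProduct.map LinearMap.id (g y) t = 0 := by
      intro y
      refine eq_zero_of_slice fun ω => hf _ fun x => ?_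
      rw [slice_map, LinearMap.id_apply, ← slice_map, ht, map_zero]
    have h2 : TensorProduct.comm ℂ C D t = 0 := by
      refine eq_zero_of_slice fun ω => hg _ fun y => ?_
      have := slice_map (g y) LinearMap.id ω (TensorProduct.comm ℂ C D t)
      rw [LinearMap.comp_id] at this
      rw [← this, TensorProduct.map_comm, h1, map_zero, map_zero]
    simpa using h2
  refine ⟨fun t ht => ?_, fun t ht => ?_⟩
  · refine aux (fun x => LinearMap.mulRight ℂ x) (fun y => LinearMap.mulRight ℂ y)
      (fun c h => hC.1 c h) (fun d h => hD.1 d h) t fun x y => ?_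
    rw [← ht (x ⊗ₜ y)]
    exact congrArg (fun m => right m t) (of_tmul x y).symm
  · refine aux (fun x => LinearMap.mulLeft ℂ x) (fun y => LinearMap.mulLeft ℂ y)
      (fun c h => hC.2 c h) (fun d h => hD.2 d h) t fun x y => ?_
    rw [← ht (x ⊗ₜ y)]
    exact congrArg (fun m => left m t) (of_tmul x y).symm

/-- A regular multiplier Hopf algebra over `ℂ`: an algebra `A` with non-degenerate product and a
coproduct, that is, a coassociative homomorphism `Δ : A → M(A ⊗ A)`, such that the four canonical
maps `a ⊗ b ↦ Δ(a)(1 ⊗ b)`, `(a ⊗ 1)Δ(b)`, `Δ(a)(b ⊗ 1)`, `(1 ⊗ a)Δ(b)` have values in `A ⊗ A`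
and are bijective from `A ⊗ A` to itself. -/
structure RegularMultiplierHopfAlgebra (A : Type u) [NonUnitalRing A] [Module ℂ A]
    [IsScalarTower ℂ A A] [SMulCommClass ℂ A A] where
  nondegenerate : IsNondegenerate A
  /-- the coproduct -/
  Δ : A →ₙₐ[ℂ] Multiplier (A ⊗[ℂ] A)
  /-- `a ⊗ b ↦ Δ(a)(1 ⊗ b)` -/
  T₁ : A ⊗[ℂ] A ≃ₗ[ℂ] A ⊗[ℂ] A
  T₁_spec : ∀ a b : A, of (T₁ (a ⊗ₜ b)) = Δ a * tmul 1 (of b)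
  /-- `a ⊗ b ↦ (a ⊗ 1)Δ(b)` -/
  T₂ : A ⊗[ℂ] A ≃ₗ[ℂ] A ⊗[ℂ] A
  T₂_spec : ∀ a b : A, of (T₂ (a ⊗ₜ b)) = tmul (of a) 1 * Δ b
  /-- `a ⊗ b ↦ Δ(a)(b ⊗ 1)` -/
  T₃ : A ⊗[ℂ] A ≃ₗ[ℂ] A ⊗[ℂ] A
  T₃_spec : ∀ a b : A, of (T₃ (a ⊗ₜ b)) = Δ a * tmul (of b) 1
  /-- `a ⊗ b ↦ (1 ⊗ a)Δ(b)` -/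
  T₄ : A ⊗[ℂ] A ≃ₗ[ℂ] A ⊗[ℂ] A
  T₄_spec : ∀ a b : A, of (T₄ (a ⊗ₜ b)) = tmul 1 (of a) * Δ b
  /-- `(a ⊗ 1 ⊗ 1)(Δ ⊗ ι)(Δ(b)(1 ⊗ c)) = (ι ⊗ Δ)((a ⊗ 1)Δ(b))(1 ⊗ 1 ⊗ c)` -/
  coassoc : ∀ a b c : A,
    LinearMap.rTensor A T₂.toLinearMap ((TensorProduct.assoc ℂ A A A).symm (a ⊗ₜ T₁ (b ⊗ₜ c))) =
      (TensorProduct.assoc ℂ A A A).symm (LinearMap.lTensor A T₁.toLinearMap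
        (TensorProduct.assoc ℂ A A A (T₂ (a ⊗ₜ b) ⊗ₜ c)))

/-- An algebraic quantum group: a regular multiplier Hopf algebra with a non-zero left integral,
which is fixed. Left invariance is the equality `(ι ⊗ φ)Δ(a) = φ(a) 1` in `M(A)`. -/
structure AlgebraicQuantumGroup (A : Type u) [NonUnitalRing A] [Module ℂ A]
    [IsScalarTower ℂ A A] [SMulCommClass ℂ A A] extends RegularMultiplierHopfAlgebra A where
  /-- the left integral -/
  φ : A →ₗ[ℂ] ℂ
  φ_ne_zero : φ ≠ 0
  left_invariant : ∀ a x : A, slice φ (T₃ (a ⊗ₜ x)) = φ a • x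
  left_invariant' : ∀ a x : A, slice φ (T₂ (x ⊗ₜ a)) = φ a • x

namespace RegularMultiplierHopfAlgebra

variable {A : Type u} [NonUnitalRing A] [Module ℂ A] [IsScalarTower ℂ A A] [SMulCommClass ℂ A A]
variable (H : RegularMultiplierHopfAlgebra A)

theorem nondeg2 (H : RegularMultiplierHopfAlgebra A) : IsNondegenerate (A ⊗[ℂ] A) :=
  H.nondegenerate.tensor H.nondegenerate

theorem mulLeft_T₁ (e a c : A) :
    TensorProduct.map (LinearMap.mulLeft ℂ e) LinearMap.id (H.T₁ (a ⊗ₜ c)) =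
      TensorProduct.map LinearMap.id (LinearMap.mulRight ℂ c) (H.T₂ (e ⊗ₜ a)) := by
  apply of_injective H.nondeg2
  have h1 := mul_of H.nondeg2 (tmul (of e) 1) (H.T₁ (a ⊗ₜ c))
  have h2 := of_mul H.nondeg2 (tmul 1 (of c)) (H.T₂ (e ⊗ₜ a))
  rw [H.T₁_spec, ← mul_assoc, ← H.T₂_spec, h2] at h1
  exact h1.symm

theorem mulRight_T₁ (a c d : A) :
    TensorProduct.map (LinearMap.mulRight ℂ c) LinearMap.id (H.T₁ (a ⊗ₜ d)) =
      left (H.Δ a) (c ⊗ₜ d) := by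
  apply of_injective H.nondeg2
  rw [← mul_of H.nondeg2, of_tmul]
  have h2 := of_mul H.nondeg2 (tmul (of c) 1) (H.T₁ (a ⊗ₜ d))
  refine h2.symm.trans ?_
  rw [H.T₁_spec, mul_assoc, tmul_mul_tmul, one_mul, mul_one]

theorem left_T₃ (x p q : A) : left (H.Δ x) (H.T₃ (p ⊗ₜ q)) = H.T₃ ((x * p) ⊗ₜ q) := by
  apply of_injective H.nondeg2
  rw [← mul_of H.nondeg2, H.T₃_spec, H.T₃_spec, map_mul, mul_assoc]

theorem right_T₂ (a a' y : A) : right (H.Δ y) (H.T₂ (a ⊗ₜ a')) = H.T₂ (a ⊗ₜ (a' * y)) := by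
  apply of_injective H.nondeg2
  rw [← of_mul H.nondeg2, H.T₂_spec, H.T₂_spec, map_mul, mul_assoc]

theorem right_tmul_eq (p q y : A) : right (H.Δ y) (p ⊗ₜ q) =
    TensorProduct.map LinearMap.id (LinearMap.mulLeft ℂ q) (H.T₂ (p ⊗ₜ y)) := by
  apply of_injective H.nondeg2
  rw [← of_mul H.nondeg2, of_tmul]
  have h := mul_of H.nondeg2 (tmul 1 (of q)) (H.T₂ (p ⊗ₜ y))
  refine Eq.trans ?_ h
  rw [H.T₂_spec, ← mul_assoc, tmul_mul_tmul, one_mul, mul_one]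

theorem mulRight_T₂ (p y z : A) :
    TensorProduct.map (LinearMap.mulRight ℂ z) LinearMap.id (H.T₂ (p ⊗ₜ y)) =
      TensorProduct.map (LinearMap.mulLeft ℂ p) LinearMap.id (H.T₃ (y ⊗ₜ z)) := by
  apply of_injective H.nondeg2
  have h1 := mul_of H.nondeg2 (tmul (of p) 1) (H.T₃ (y ⊗ₜ z))
  have h2 := of_mul H.nondeg2 (tmul (of z) 1) (H.T₂ (p ⊗ₜ y))
  rw [H.T₃_spec, ← mul_assoc, ← H.T₂_spec, h2] at h1
  exact h1

end RegularMultiplierHopfAlgebra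

namespace AlgebraicQuantumGroup

variable {A : Type u} [NonUnitalRing A] [Module ℂ A] [IsScalarTower ℂ A A] [SMulCommClass ℂ A A]
variable (H : AlgebraicQuantumGroup A)

/-- The map `c ↦ φ(· c)` from `A` to its linear dual. -/
def fourier : A →ₗ[ℂ] Module.Dual ℂ A where
  toFun c := H.φ ∘ₗ LinearMap.mulRight ℂ c
  map_add' c d := by ext; simp [mul_add]
  map_smul' r c := by ext; simp [mul_smul_comm]

@[simp] theorem fourier_apply (c x : A) : H.fourier c x = H.φ (x * c) := rfl

/-- The dual `B = Â`: the space of all functionals `φ(· c)` with `c ∈ A`. -/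
def Dual : Type u := LinearMap.range H.fourier

instance : AddCommGroup H.Dual := inferInstanceAs (AddCommGroup (LinearMap.range H.fourier))

instance : Module ℂ H.Dual := inferInstanceAs (Module ℂ (LinearMap.range H.fourier))

/-- The inclusion of `B` in the dual space of `A`; thus `⟨a, b⟩ = H.eval b a`. -/
def eval : H.Dual →ₗ[ℂ] Module.Dual ℂ A := (LinearMap.range H.fourier).subtype

/-- The element `φ(· c)` of `B`. -/
def toDual : A →ₗ[ℂ] H.Dual := H.fourier.rangeRestrict

@[simp] theorem eval_toDual (c x : A) : H.eval (H.toDual c) x = H.φ (x * c) := rfl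

theorem toDual_surjective : Function.Surjective H.toDual := LinearMap.surjective_rangeRestrict _

theorem eval_injective : Function.Injective H.eval := Subtype.coe_injective

theorem dual_ext {b b' : H.Dual} (h : ∀ x, H.eval b x = H.eval b' x) : b = b' :=
  H.eval_injective (LinearMap.ext h)

/-- A functional of the form `φ(· c)` as an element of `B`. -/
def ofRange (f : Module.Dual ℂ A) (h : ∃ c, H.fourier c = f) : H.Dual := ⟨f, h⟩

@[simp] theorem eval_ofRange (f : Module.Dual ℂ A) (h : ∃ c, H.fourier c = f) :
    H.eval (H.ofRange f h) = f := rfl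

/-- The map `c ↦ (a ↦ (ι ⊗ φ)(Δ(a)(1 ⊗ c)))`. -/
def actAux : A →ₗ[ℂ] A →ₗ[ℂ] A :=
  LinearMap.mk₂ ℂ (fun c a => slice H.φ (H.T₁ (a ⊗ₜ c)))
    (by intros; simp [TensorProduct.tmul_add]) (by intros; simp)
    (by intros; simp [TensorProduct.add_tmul]) (by intros; simp [← TensorProduct.smul_tmul'])

theorem mul_actAux (c a e : A) :
    e * H.actAux c a = slice (H.fourier c) (H.T₂ (e ⊗ₜ a)) := by
  have h1 := slice_map (LinearMap.mulLeft ℂ e) LinearMap.id H.φ (H.T₁ (a ⊗ₜ c))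
  rw [H.mulLeft_T₁, slice_map] at h1
  exact h1.symm

theorem ker_fourier_le : LinearMap.ker H.fourier ≤ LinearMap.ker H.actAux := by
  intro c hc
  rw [LinearMap.mem_ker] at hc ⊢
  ext a
  apply H.nondegenerate.2
  intro e
  rw [mul_actAux, hc]
  simp [slice]

/-- The left action of `B` on `A`: `b ▷ a = (ι ⊗ ⟨·, b⟩)Δ(a)`, that is,
`b ▷ a = (ι ⊗ φ)(Δ(a)(1 ⊗ c))` for `b = φ(· c)`. -/
def act : H.Dual →ₗ[ℂ] A →ₗ[ℂ] A :=
  (LinearMap.ker H.fourier).liftQ H.actAux H.ker_fourier_le ∘ₗ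
    H.fourier.quotKerEquivRange.symm.toLinearMap

theorem act_toDual (c a : A) : H.act (H.toDual c) a = slice H.φ (H.T₁ (a ⊗ₜ c)) := by
  have h1 : H.fourier.quotKerEquivRange.symm (H.fourier.rangeRestrict c) =
      Submodule.Quotient.mk c := by
    rw [LinearEquiv.symm_apply_eq]; rfl
  exact LinearMap.congr_fun
    (congrArg ((LinearMap.ker H.fourier).liftQ H.actAux H.ker_fourier_le) h1) a

/-- `e (b ▷ a) = (ι ⊗ ⟨·, b⟩)((e ⊗ 1)Δ(a))`. -/
theorem mul_act (b : H.Dual) (a e : A) :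
    e * H.act b a = slice (H.eval b) (H.T₂ (e ⊗ₜ a)) := by
  obtain ⟨c, rfl⟩ := H.toDual_surjective b
  rw [act_toDual]
  exact H.mul_actAux c a e

theorem act_mul (s : A ⊗[ℂ] A) (x c c' : A) (hs : H.T₃ s = c ⊗ₜ c') :
    H.act (H.toDual c') x * c = TensorProduct.lid ℂ A
      (TensorProduct.map (H.φ ∘ₗ LinearMap.mulLeft ℂ x) LinearMap.id s) := by
  have h1 := slice_map (LinearMap.mulRight ℂ c) LinearMap.id H.φ (H.T₁ (x ⊗ₜ c'))
  rw [H.mulRight_T₁, ← hs] at h1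
  rw [act_toDual]
  refine h1.symm.trans ?_
  clear h1 hs
  induction s with
  | zero => simp
  | add s₁ s₂ h₁ h₂ => simp only [map_add, h₁, h₂]
  | tmul p q => simp [H.left_T₃, H.left_invariant]

theorem mul_mem (f : A →ₗ[ℂ] A) (b b' : H.Dual) (hf : ∃ a, f = LinearMap.mulLeft ℂ a ∨ f = 1) :
    ∃ d, H.fourier d = H.eval b ∘ₗ f ∘ₗ H.act b' := by
  obtain ⟨c, rfl⟩ := H.toDual_surjective b
  obtain ⟨c', rfl⟩ := H.toDual_surjective b'
  obtain ⟨s, hs⟩ := H.T₃.surjective (c ⊗ₜ c')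
  refine ⟨slice (H.φ ∘ₗ f) s, ?_⟩
  ext x
  have hx : (H.eval (H.toDual c) ∘ₗ f ∘ₗ H.act (H.toDual c')) x =
      H.φ (f (H.act (H.toDual c') x * c)) := by
    obtain ⟨a, rfl | rfl⟩ := hf
    · simp [mul_assoc]
    · simp
  rw [hx, H.act_mul s x c c' hs]
  clear hx hs
  induction s with
  | zero => simp
  | add s₁ s₂ h₁ h₂ =>
    simp only [map_add, LinearMap.add_apply] at h₁ h₂ ⊢
    rw [h₁, h₂]
  | tmul p q => simp [mul_comm]

/-- The product of `B`: `⟨a, b b'⟩ = ⟨Δ(a), b ⊗ b'⟩ = ⟨b' ▷ a, b⟩`. -/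
instance : Mul H.Dual :=
  ⟨fun b b' => H.ofRange (H.eval b ∘ₗ H.act b') (H.mul_mem 1 b b' ⟨0, Or.inr rfl⟩)⟩

@[simp] theorem eval_mul (b b' : H.Dual) (a : A) : H.eval (b * b') a = H.eval b (H.act b' a) := rfl

/-- `(ι ⊗ b ▷)((p ⊗ 1)Δ(x)) = (p ⊗ 1)Δ(b ▷ x)`. -/
theorem lTensor_act (b : H.Dual) (p x : A) :
    LinearMap.lTensor A (H.act b) (H.T₂ (p ⊗ₜ x)) = H.T₂ (p ⊗ₜ H.act b x) := by
  obtain ⟨c, rfl⟩ := H.toDual_surjective b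
  have h := congrArg (slice H.φ) (H.coassoc p x c)
  have e1 : ∀ t : A ⊗[ℂ] A, slice H.φ (LinearMap.rTensor A H.T₂.toLinearMap
      ((TensorProduct.assoc ℂ A A A).symm (p ⊗ₜ t))) = H.T₂ (p ⊗ₜ slice H.φ t) := by
    intro t
    induction t with
    | zero => simp
    | add x y h₁ h₂ => simp only [TensorProduct.tmul_add, map_add, h₁, h₂]
    | tmul u v => simp
  have e3 : ∀ (u : A) (r : A ⊗[ℂ] A), slice H.φ ((TensorProduct.assoc ℂ A A A).symm (u ⊗ₜ r)) =
      u ⊗ₜ slice H.φ r := by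
    intro u r
    induction r with
    | zero => simp
    | add x y h₁ h₂ => simp only [TensorProduct.tmul_add, map_add, h₁, h₂]
    | tmul u v => simp
  have e2 : ∀ t : A ⊗[ℂ] A, slice H.φ ((TensorProduct.assoc ℂ A A A).symm
      (LinearMap.lTensor A H.T₁.toLinearMap (TensorProduct.assoc ℂ A A A (t ⊗ₜ c)))) =
        LinearMap.lTensor A (H.act (H.toDual c)) t := by
    intro t
    induction t with
    | zero => simp
    | add x y h₁ h₂ => simp only [TensorProduct.add_tmul, map_add, h₁, h₂]
    | tmul u v => simp [e3, act_toDual]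
  rw [e1, e2] at h
  rw [← h, act_toDual]

/-- `(b b') ▷ a = b ▷ (b' ▷ a)`. -/
theorem act_mul_apply (b b' : H.Dual) (a : A) : H.act (b * b') a = H.act b (H.act b' a) := by
  rw [← sub_eq_zero]
  apply H.nondegenerate.2
  intro e
  rw [mul_sub, mul_act, mul_act, ← lTensor_act, sub_eq_zero]
  have := slice_map (X := A) LinearMap.id (H.act b') (H.eval b) (H.T₂ (e ⊗ₜ a))
  exact this.symm

instance : NonUnitalRing H.Dual where
  left_distrib b c d := H.dual_ext fun x => by simp
  right_distrib b c d := H.dual_ext fun x => by simp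
  zero_mul b := H.dual_ext fun x => by simp
  mul_zero b := H.dual_ext fun x => by simp
  mul_assoc b c d := H.dual_ext fun x => by simp [act_mul_apply]

instance : IsScalarTower ℂ H.Dual H.Dual :=
  ⟨fun r b c => H.dual_ext fun x => by simp⟩

instance : SMulCommClass ℂ H.Dual H.Dual :=
  ⟨fun r b c => H.dual_ext fun x => by simp⟩

/-- The left action of `A` on `B`: `⟨a', a ▷ b⟩ = ⟨a' a, b⟩`. -/
def actDual (a : A) (b : H.Dual) : H.Dual :=
  H.ofRange (H.eval b ∘ₗ LinearMap.mulRight ℂ a) (by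
    obtain ⟨c, rfl⟩ := H.toDual_surjective b
    exact ⟨a * c, by ext x; simp [mul_assoc]⟩)

/-- The element `(b ◁ a) b'` of `B`, where `⟨a', b ◁ a⟩ = ⟨a a', b⟩`,
so that `⟨x, (b ◁ a) b'⟩ = ⟨a (b' ▷ x), b⟩`. -/
def actMul (b b' : H.Dual) (a : A) : H.Dual :=
  H.ofRange (H.eval b ∘ₗ LinearMap.mulLeft ℂ a ∘ₗ H.act b')
    (H.mul_mem (LinearMap.mulLeft ℂ a) b b' ⟨a, Or.inl rfl⟩)

@[simp] theorem eval_actMul (b b' : H.Dual) (a x : A) :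
    H.eval (H.actMul b b' a) x = H.eval b (a * H.act b' x) := rfl

/-- `(b ⊗ b') ↦ (a ↦ (b ◁ a) b')` as a linear map. -/
def actMulₗ : H.Dual ⊗[ℂ] H.Dual →ₗ[ℂ] A →ₗ[ℂ] H.Dual :=
  TensorProduct.lift (LinearMap.mk₂ ℂ
    (fun b b' =>
      { toFun := H.actMul b b'
        map_add' := fun a a' => H.dual_ext fun x => by simp [add_mul]
        map_smul' := fun r a => H.dual_ext fun x => by simp [smul_mul_assoc] })
    (fun b c b' => LinearMap.ext fun a => H.dual_ext fun x => by simp)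
    (fun r b b' => LinearMap.ext fun a => H.dual_ext fun x => by simp)
    (fun b c b' => LinearMap.ext fun a => H.dual_ext fun x => by simp [mul_add])
    (fun r b b' => LinearMap.ext fun a => H.dual_ext fun x => by simp [mul_smul_comm]))

@[simp] theorem actMulₗ_tmul (b b' : H.Dual) (a : A) :
    H.actMulₗ (b ⊗ₜ b') a = H.actMul b b' a := rfl

/-- The underlying space `A ⊗ B` of the Heisenberg algebra `AB`. -/
def Heisenberg : Type u := A ⊗[ℂ] H.Dual

instance : AddCommGroup H.Heisenberg := inferInstanceAs (AddCommGroup (A ⊗[ℂ] H.Dual))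

instance : Module ℂ H.Heisenberg := inferInstanceAs (Module ℂ (A ⊗[ℂ] H.Dual))

/-- The element `a ⊗ b` of the Heisenberg algebra. -/
def heis : A →ₗ[ℂ] H.Dual →ₗ[ℂ] H.Heisenberg := TensorProduct.mk ℂ A H.Dual

/-- The product of the Heisenberg algebra,
`(a ⊗ b)(a' ⊗ b') = ∑ ⟨a'₍₂₎, b₍₁₎⟩ a a'₍₁₎ ⊗ b₍₂₎ b' = ∑ a a'₍₁₎ ⊗ (b ◁ a'₍₂₎) b'`.
Here `∑ a a'₍₁₎ ⊗ a'₍₂₎ = (a ⊗ 1)Δ(a')` is in `A ⊗ A`, and `∑ ⟨a, b₍₁₎⟩ b₍₂₎ = b ◁ a`. -/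
def heisMul : H.Heisenberg →ₗ[ℂ] H.Heisenberg →ₗ[ℂ] H.Heisenberg :=
  TensorProduct.curry
    (LinearMap.lTensor A (TensorProduct.lift H.actMulₗ.flip) ∘ₗ
      (TensorProduct.assoc ℂ A A (H.Dual ⊗[ℂ] H.Dual)).toLinearMap ∘ₗ
      LinearMap.rTensor (H.Dual ⊗[ℂ] H.Dual) H.T₂.toLinearMap ∘ₗ
      (TensorProduct.tensorTensorTensorComm ℂ A H.Dual A H.Dual).toLinearMap)

instance : Mul H.Heisenberg := ⟨fun x y => H.heisMul x y⟩

theorem heis_mul_heis (a a' : A) (b b' : H.Dual) :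
    H.heis a b * H.heis a' b' =
      (LinearMap.lTensor A (H.actMulₗ (b ⊗ₜ b')) (H.T₂ (a ⊗ₜ a')) : A ⊗[ℂ] H.Dual) := by
  change LinearMap.lTensor A (TensorProduct.lift H.actMulₗ.flip)
    (TensorProduct.assoc ℂ A A (H.Dual ⊗[ℂ] H.Dual) (H.T₂ (a ⊗ₜ a') ⊗ₜ (b ⊗ₜ b'))) = _
  generalize H.T₂ (a ⊗ₜ a') = w
  induction w with
  | zero => simp
  | add w₁ w₂ h₁ h₂ => simp only [TensorProduct.add_tmul, map_add, h₁, h₂]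
  | tmul p q => simp

/-- The action of the Heisenberg algebra on `A`: `(a ⊗ b) ▷ x = a (b ▷ x)`. -/
def heisAct : H.Heisenberg →ₗ[ℂ] A →ₗ[ℂ] A :=
  TensorProduct.lift (LinearMap.mk₂ ℂ (fun a b => LinearMap.mulLeft ℂ a ∘ₗ H.act b)
    (by intros; ext; simp [add_mul]) (by intros; ext; simp [smul_mul_assoc])
    (by intros; ext; simp [mul_add]) (by intros; ext; simp))

@[simp] theorem heisAct_heis (a : A) (b : H.Dual) (x : A) :
    H.heisAct (H.heis a b) x = a * H.act b x := rfl

theorem heis_induction {p : H.Heisenberg → Prop} (h : ∀ a b, p (H.heis a b))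
    (hadd : ∀ x y, p x → p y → p (x + y)) (x : H.Heisenberg) : p x := by
  induction x using TensorProduct.induction_on with
  | zero =>
    have h0 := h 0 0
    rw [map_zero] at h0
    exact h0
  | tmul a b => exact h a b
  | add x y hx hy => exact hadd x y hx hy

theorem heisAct_mul (s t : H.Heisenberg) (x : A) :
    H.heisAct (s * t) x = H.heisAct s (H.heisAct t x) := by
  induction s using H.heis_induction with
  | hadd s₁ s₂ h₁ h₂ =>
    change H.heisAct (H.heisMul (s₁ + s₂) t) x = _
    rw [map_add, LinearMap.add_apply, map_add, LinearMap.add_apply, map_add, LinearMap.add_apply]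
    exact congrArg₂ (· + ·) h₁ h₂
  | h a b =>
    induction t using H.heis_induction with
    | hadd t₁ t₂ h₁ h₂ =>
      change H.heisAct (H.heisMul _ (t₁ + t₂)) x = _
      rw [map_add, map_add, LinearMap.add_apply, map_add, LinearMap.add_apply, map_add]
      exact congrArg₂ (· + ·) h₁ h₂
    | h a' b' =>
      rw [heisAct_heis, heisAct_heis, mul_act, ← H.right_T₂, heis_mul_heis]
      generalize H.T₂ (a ⊗ₜ a') = w
      induction w with
      | zero =>
        simp only [map_zero]
        exact LinearMap.congr_fun (map_zero H.heisAct) x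
      | add w₁ w₂ h₁ h₂ =>
        simp only [map_add]
        rw [← h₁, ← h₂]
        exact LinearMap.congr_fun (map_add H.heisAct _ _) x
      | tmul p q =>
        have h1 : H.heisAct (LinearMap.lTensor A (H.actMulₗ (b ⊗ₜ b')) (p ⊗ₜ q)) x =
            p * H.act (H.actMul b b' q) x := rfl
        rw [h1, mul_act, H.right_tmul_eq, ← lTensor_act, slice_map]
        have := slice_map (X := A) LinearMap.id (H.act b') (H.eval b ∘ₗ LinearMap.mulLeft ℂ q)
          (H.T₂ (p ⊗ₜ x))
        exact this.symm

/-- The action of the Heisenberg algebra on `A` is faithful. -/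
theorem heisAct_injective (s : H.Heisenberg) (h : ∀ x, H.heisAct s x = 0) : s = 0 := by
  -- `∑ a ⊗ b` acts on `u ⊗ v` as `∑ ⟨v, b⟩ a u`
  let K : H.Heisenberg →ₗ[ℂ] A ⊗[ℂ] A →ₗ[ℂ] A :=
    TensorProduct.lift (LinearMap.mk₂ ℂ (fun a b => LinearMap.mulLeft ℂ a ∘ₗ slice (H.eval b))
      (by intros; apply TensorProduct.ext'; intros; simp [add_mul])
      (by intros; apply TensorProduct.ext'; intros; simp only [smul_mul_assoc,
        LinearMap.comp_apply, LinearMap.smul_apply, LinearMap.mulLeft_apply])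
      (by intros; apply TensorProduct.ext'; intros; simp [add_smul, mul_add, mul_smul_comm])
      (by intros; apply TensorProduct.ext'; intros; simp [mul_smul]))
  have hK : ∀ (s : H.Heisenberg) (x z : A), K s (H.T₃ (x ⊗ₜ z)) = H.heisAct s x * z := by
    intro s x z
    induction s using H.heis_induction with
    | hadd s₁ s₂ h₁ h₂ => simp only [map_add, LinearMap.add_apply, add_mul, h₁, h₂]
    | h a b =>
      change a * slice (H.eval b) (H.T₃ (x ⊗ₜ z)) = _
      rw [heisAct_heis, mul_act]
      have h1 := slice_map (LinearMap.mulRight ℂ z) LinearMap.id (H.eval b) (H.T₂ (a ⊗ₜ x))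
      rw [H.mulRight_T₂, slice_map] at h1
      exact h1
  have hK0 : ∀ w, K s w = 0 := by
    intro w
    obtain ⟨w, rfl⟩ := H.T₃.surjective w
    induction w with
    | zero => simp
    | add w₁ w₂ h₁ h₂ => rw [map_add, map_add, h₁, h₂, add_zero]
    | tmul x z => rw [hK, h, zero_mul]
  -- pair the second leg with `v`
  have hv : ∀ v : A, slice (H.eval.flip v) (s : A ⊗[ℂ] H.Dual) = 0 := by
    intro v
    apply H.nondegenerate.1
    intro u
    have : ∀ s : H.Heisenberg, slice (H.eval.flip v) (s : A ⊗[ℂ] H.Dual) * u = K s (u ⊗ₜ v) := by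
      intro s
      induction s using H.heis_induction with
      | hadd s₁ s₂ h₁ h₂ =>
        rw [map_add, LinearMap.add_apply, ← h₁, ← h₂, ← add_mul]
        exact congrArg (· * u) (map_add (slice (H.eval.flip v)) _ _)
      | h a b =>
        change slice (H.eval.flip v) (a ⊗ₜ b) * u = a * slice (H.eval b) (u ⊗ₜ v)
        simp [smul_mul_assoc, mul_smul_comm]
    rw [this, hK0]
  have hc : TensorProduct.comm ℂ A H.Dual s = 0 := by
    refine eq_zero_of_slice fun ω => H.dual_ext fun v => ?_
    have h2 : ∀ t : A ⊗[ℂ] H.Dual, H.eval (slice ω (TensorProduct.comm ℂ A H.Dual t)) v =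
        ω (slice (H.eval.flip v) t) := by
      intro t
      induction t with
      | zero => simp
      | add t₁ t₂ h₁ h₂ => simp only [map_add, LinearMap.add_apply, h₁, h₂]
      | tmul a b => simp [mul_comm]
    have := h2 s
    rw [hv] at this
    simpa using this
  exact (LinearEquiv.map_eq_zero_iff (TensorProduct.comm ℂ A H.Dual)).mp hc

theorem heis_ext {s t : H.Heisenberg} (h : ∀ x, H.heisAct s x = H.heisAct t x) : s = t := by
  rw [← sub_eq_zero]
  apply H.heisAct_injective
  intro x
  rw [map_sub, LinearMap.sub_apply, h, sub_self]

/-- The Heisenberg algebra `AB`. -/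
instance : NonUnitalRing H.Heisenberg where
  left_distrib x y z := map_add (H.heisMul x) y z
  right_distrib x y z := LinearMap.congr_fun (map_add H.heisMul x y) z
  zero_mul x := LinearMap.congr_fun (map_zero H.heisMul) x
  mul_zero x := map_zero (H.heisMul x)
  mul_assoc x y z := H.heis_ext fun u => by simp only [heisAct_mul]

instance : IsScalarTower ℂ H.Heisenberg H.Heisenberg :=
  ⟨fun r x y => LinearMap.congr_fun (map_smul H.heisMul r x) y⟩

instance : SMulCommClass ℂ H.Heisenberg H.Heisenberg :=
  ⟨fun r x y => (map_smul (H.heisMul x) r y).symm⟩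

/-- The pairing of `B ⊗ B` with `A ⊗ A`: `⟨a ⊗ a', b ⊗ b'⟩ = ⟨a, b⟩⟨a', b'⟩`. -/
def pairDual : H.Dual ⊗[ℂ] H.Dual →ₗ[ℂ] Module.Dual ℂ (A ⊗[ℂ] A) :=
  TensorProduct.dualDistrib ℂ A A ∘ₗ TensorProduct.map H.eval H.eval

/-- The pairing of `B ⊗ A` with `A ⊗ B`: `⟨b ⊗ a, a' ⊗ b'⟩ = ⟨a', b⟩⟨a, b'⟩`. -/
def pairMixed : H.Dual ⊗[ℂ] A →ₗ[ℂ] Module.Dual ℂ (A ⊗[ℂ] H.Dual) :=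
  TensorProduct.dualDistrib ℂ A H.Dual ∘ₗ TensorProduct.map H.eval H.eval.flip

/-- `ΔB` is the coproduct of `B`: `⟨a ⊗ a', ΔB(b)⟩ = ⟨a a', b⟩`, for the pairing of `A ⊗ A` with
`M(B ⊗ B)` given by `⟨y ▷ x, n⟩ = ⟨x, n y⟩` for `x ∈ A ⊗ A` and `y ∈ B ⊗ B`. -/
def IsDualCoproduct (ΔB : H.Dual →ₙₐ[ℂ] Multiplier (H.Dual ⊗[ℂ] H.Dual)) : Prop :=
  ∀ (b b₁ b₂ : H.Dual) (a₁ a₂ : A),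
    H.pairDual (left (ΔB b) (b₁ ⊗ₜ b₂)) (a₁ ⊗ₜ a₂) = H.eval b (H.act b₁ a₁ * H.act b₂ a₂)

/-- `V ∈ M(B ⊗ A)` is the duality: `⟨V, a ⊗ b⟩ = ⟨a, b⟩`, for the pairing of `M(B ⊗ A)` with
`A ⊗ B` given by `⟨m, y ▷ x⟩ = ⟨m y, x⟩` for `x ∈ A ⊗ B` and `y ∈ B ⊗ A`. -/
def IsDuality (V : Multiplier (H.Dual ⊗[ℂ] A)) : Prop :=
  ∀ (b : H.Dual) (a a' : A) (b' : H.Dual),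
    H.pairMixed (left V (b ⊗ₜ a)) (a' ⊗ₜ b') = H.eval (H.actDual a b') (H.act b a')

/-- `jA` and `jB` are the embeddings of `A` and `B` in `M(AB)`, characterized by
`jA(a)(a' ⊗ b') = a a' ⊗ b'` and `(a' ⊗ b') jB(b) = a' ⊗ b' b`. -/
def IsHeisenbergEmbedding (jA : A →ₙₐ[ℂ] Multiplier H.Heisenberg)
    (jB : H.Dual →ₙₐ[ℂ] Multiplier H.Heisenberg) : Prop :=
  (∀ (a a' : A) (b' : H.Dual), left (jA a) (H.heis a' b') = H.heis (a * a') b') ∧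
  (∀ (b : H.Dual) (a' : A) (b' : H.Dual), right (jB b) (H.heis a' b') = H.heis a' (b' * b))

section Relations

variable {C : Type v} [NonUnitalRing C] [Module ℂ C] [IsScalarTower ℂ C C] [SMulCommClass ℂ C C]
variable (jA : A →ₙₐ[ℂ] Multiplier C) (jB : H.Dual →ₙₐ[ℂ] Multiplier C)

/-- The linear map `a ⊗ b ↦ jA(a) jB(b)`. -/
def productMap : H.Heisenberg →ₗ[ℂ] Multiplier C :=
  TensorProduct.lift ((LinearMap.mul ℂ (Multiplier C)).compl₁₂
    (jA : A →ₗ[ℂ] Multiplier C) (jB : H.Dual →ₗ[ℂ] Multiplier C))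

/-- The Heisenberg commutation relations
`jB(b) jA(a') = ∑ ⟨a'₍₂₎, b₍₁₎⟩ jA(a'₍₁₎) jB(b₍₂₎)` for homomorphisms of `A` and `B` to `M(C)`.
They are multiplied by `jA(a)` from the left and by `jB(b')` from the right, and then the right
hand side is the image of `∑ ⟨a'₍₂₎, b₍₁₎⟩ a a'₍₁₎ ⊗ b₍₂₎ b'` in `A ⊗ B`. -/
def HeisenbergRelations : Prop :=
  ∀ (a a' : A) (b b' : H.Dual),
    jA a * (jB b * jA a') * jB b' = H.productMap jA jB (H.heis a b * H.heis a' b')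

/-- `Δ(a) V = V (a ⊗ 1)` in `M(C ⊗ A)` for all `a ∈ A`. -/
def FirstFormula (V : Multiplier (H.Dual ⊗[ℂ] A)) : Prop :=
  ∀ a : A,
    extend (tensorHom jA (ofHom A)) (H.Δ a) * extend (tensorHom jB (ofHom A)) V =
      extend (tensorHom jB (ofHom A)) V * tmul (jA a) 1

/-- `V Δ(b) = (1 ⊗ b) V` in `M(B ⊗ C)` for all `b ∈ B`. -/
def SecondFormula (ΔB : H.Dual →ₙₐ[ℂ] Multiplier (H.Dual ⊗[ℂ] H.Dual))
    (V : Multiplier (H.Dual ⊗[ℂ] A)) : Prop :=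
  ∀ b : H.Dual,
    extend (tensorHom (ofHom H.Dual) jA) V * extend (tensorHom (ofHom H.Dual) jB) (ΔB b) =
      tmul 1 (jB b) * extend (tensorHom (ofHom H.Dual) jA) V

end Relations

end AlgebraicQuantumGroup

end MultiplierHopf

end

/-!
Every element of `B` is of the form `φ(· c)`, so identities between elements and multipliers built
from `B` can be tested by slicing with `φ` and by evaluating at elements of `A`. Bijectivity of the
Galois maps yields a counit, whence the action `▷` of `B` on `A` is faithful and spans `A`; the
Heisenberg algebra then acts faithfully on `A`, which gives its associativity and non-degeneracy.

The key identity is `S((ι ⊗ φ)(Δ(x)(1 ⊗ z))) = (ι ⊗ φ)((1 ⊗ x)Δ(z))`. It defines the antipode `S`,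
which makes `φ ∘ S` a right integral and supplies the right-handed counterparts of all statements.
The multipliers `V` and `Δ(b)` are constructed from their evaluations at `A`, and the two formulas
for `V`, when sliced with `φ` and evaluated at elements of `A` respectively, each become the
commutation relations `b a = ∑ ⟨a₍₂₎, b₍₁₎⟩ a₍₁₎ b₍₂₎`.
-/

noncomputable section

namespace MultiplierHopf

universe u v w

open Multiplier

section TensorSlices

variable {X Y Z : Type*} [AddCommGroup X] [Module ℂ X] [AddCommGroup Y] [Module ℂ Y]
  [AddCommGroup Z] [Module ℂ Z]

/-- The slice map `ω ⊗ ι : X ⊗ Y → Y` for a linear functional `ω` on `X`. -/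
def lslice (ω : X →ₗ[ℂ] ℂ) : X ⊗[ℂ] Y →ₗ[ℂ] Y :=
  (TensorProduct.lid ℂ Y).toLinearMap ∘ₗ LinearMap.rTensor Y ω

@[simp] theorem lslice_tmul (ω : X →ₗ[ℂ] ℂ) (x : X) (y : Y) :
    lslice ω (x ⊗ₜ[ℂ] y) = ω x • y := by
  simp [lslice]

theorem slice_lTensor (g : Y →ₗ[ℂ] Z) (ω : Z →ₗ[ℂ] ℂ) (t : X ⊗[ℂ] Y) :
    slice ω (LinearMap.lTensor X g t) = slice (ω ∘ₗ g) t :=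
  slice_map LinearMap.id g ω t

theorem slice_rTensor (f : X →ₗ[ℂ] Z) (ω : Y →ₗ[ℂ] ℂ) (t : X ⊗[ℂ] Y) :
    slice ω (LinearMap.rTensor Y f t) = f (slice ω t) :=
  slice_map f LinearMap.id ω t

theorem lslice_comm (ω : Y →ₗ[ℂ] ℂ) (t : X ⊗[ℂ] Y) :
    lslice ω (TensorProduct.comm ℂ X Y t) = slice ω t := by
  induction t <;> simp_all

theorem lslice_map {X' Y' : Type*} [AddCommGroup X'] [Module ℂ X'] [AddCommGroup Y'] [Module ℂ Y']
    (f : X →ₗ[ℂ] X') (g : Y →ₗ[ℂ] Y') (ω : X' →ₗ[ℂ] ℂ) (t : X ⊗[ℂ] Y) :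
    lslice ω (TensorProduct.map f g t) = g (lslice (ω ∘ₗ f) t) := by
  induction t <;> simp_all

theorem lslice_rTensor (f : X →ₗ[ℂ] Z) (ω : Z →ₗ[ℂ] ℂ) (t : X ⊗[ℂ] Y) :
    lslice ω (LinearMap.rTensor Y f t) = lslice (ω ∘ₗ f) t :=
  lslice_map f LinearMap.id ω t

theorem lslice_lTensor (g : Y →ₗ[ℂ] Z) (ω : X →ₗ[ℂ] ℂ) (t : X ⊗[ℂ] Y) :
    lslice ω (LinearMap.lTensor X g t) = g (lslice ω t) :=
  lslice_map LinearMap.id g ω t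

theorem apply_slice (ω : X →ₗ[ℂ] ℂ) (χ : Y →ₗ[ℂ] ℂ) (t : X ⊗[ℂ] Y) :
    ω (slice χ t) = χ (lslice ω t) := by
  induction t <;> simp_all [mul_comm]

theorem slice_assoc_symm (ω : Z →ₗ[ℂ] ℂ) (t : X ⊗[ℂ] (Y ⊗[ℂ] Z)) :
    slice ω ((TensorProduct.assoc ℂ X Y Z).symm t) = LinearMap.lTensor X (slice ω) t := by
  refine LinearMap.congr_fun (f := slice ω ∘ₗ (TensorProduct.assoc ℂ X Y Z).symm.toLinearMap) ?_ t
  refine TensorProduct.ext (LinearMap.ext fun x => TensorProduct.ext' fun y z => ?_)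
  simp

theorem assoc_tmul_eq_lTensor (t : X ⊗[ℂ] Y) (z : Z) :
    TensorProduct.assoc ℂ X Y Z (t ⊗ₜ z) =
      LinearMap.lTensor X ((TensorProduct.mk ℂ Y Z).flip z) t := by
  induction t <;> simp_all [TensorProduct.add_tmul]

theorem slice_surjective {ω : Y →ₗ[ℂ] ℂ} (hω : ω ≠ 0) :
    Function.Surjective (slice ω : X ⊗[ℂ] Y →ₗ[ℂ] X) := fun x => by
  obtain ⟨y, hy⟩ := LinearMap.surjective hω 1
  exact ⟨x ⊗ₜ y, by simp [hy]⟩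

theorem lslice_surjective {ω : X →ₗ[ℂ] ℂ} (hω : ω ≠ 0) :
    Function.Surjective (lslice ω : X ⊗[ℂ] Y →ₗ[ℂ] Y) := fun y => by
  obtain ⟨x, hx⟩ := LinearMap.surjective hω 1
  exact ⟨x ⊗ₜ y, by simp [hx]⟩

theorem eq_of_slice {s t : X ⊗[ℂ] Y} (h : ∀ ω : Y →ₗ[ℂ] ℂ, slice ω s = slice ω t) : s = t :=
  sub_eq_zero.mp <| eq_zero_of_slice fun ω => by rw [map_sub, h, sub_self]

theorem eq_of_lslice {s t : X ⊗[ℂ] Y} (h : ∀ ω : X →ₗ[ℂ] ℂ, lslice ω s = lslice ω t) : s = t := by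
  refine (TensorProduct.comm ℂ X Y).injective (eq_of_slice fun ω => ?_)
  simpa only [← lslice_comm, TensorProduct.comm_comm] using h ω

theorem map_mem_of_surjective {Q : Type*} [AddCommGroup Q] [Module ℂ Q]
    {e : X ⊗[ℂ] Y →ₗ[ℂ] Z} (he : Function.Surjective e) (f : Z →ₗ[ℂ] Q) {S : Submodule ℂ Q}
    (h : ∀ x y, f (e (x ⊗ₜ y)) ∈ S) (z : Z) : f z ∈ S := by
  obtain ⟨t, rfl⟩ := he z
  induction t with
  | zero => simp
  | add s t hs ht => rw [map_add, map_add]; exact S.add_mem hs ht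
  | tmul x y => exact h x y

variable {ι : Type*}

theorem mem_range_rTensor_iInf_ker (F : ι → X →ₗ[ℂ] Z) {t : X ⊗[ℂ] Y}
    (h : ∀ i, LinearMap.rTensor Y (F i) t = 0) :
    t ∈ LinearMap.range (LinearMap.rTensor Y (⨅ i, LinearMap.ker (F i)).subtype) := by
  classical
  let b := Module.Basis.ofVectorSpace ℂ Y
  let e := TensorProduct.equivFinsuppOfBasisRight (M := X) b
  have coord_mem (k) : e t k ∈ ⨅ i, LinearMap.ker (F i) := by
    have coord_eq : e t k = slice (b.coord k) t :=
      TensorProduct.equivFinsuppOfBasisRight_apply b t k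
    simp only [Submodule.mem_iInf, LinearMap.mem_ker]
    intro i
    rw [coord_eq, ← slice_rTensor, h, map_zero]
  rw [← e.symm_apply_apply t, TensorProduct.equivFinsuppOfBasisRight_symm_apply]
  exact Submodule.sum_mem _ fun k _ => ⟨⟨_, coord_mem k⟩ ⊗ₜ b k, rfl⟩

theorem mem_range_lTensor_iInf_ker (F : ι → Y →ₗ[ℂ] Z) {t : X ⊗[ℂ] Y}
    (h : ∀ i, LinearMap.lTensor X (F i) t = 0) :
    t ∈ LinearMap.range (LinearMap.lTensor X (⨅ i, LinearMap.ker (F i)).subtype) := by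
  obtain ⟨s, hs⟩ := mem_range_rTensor_iInf_ker F (t := TensorProduct.comm ℂ X Y t) fun i => by
    rw [LinearMap.rTensor_comm, h, map_zero]
  refine ⟨TensorProduct.comm ℂ _ X s, ?_⟩
  rw [LinearMap.lTensor_comm, hs, TensorProduct.comm_comm]

theorem eq_of_rTensor (F : ι → X →ₗ[ℂ] Z) (hF : ∀ x, (∀ i, F i x = 0) → x = 0) {s t : X ⊗[ℂ] Y}
    (h : ∀ i, LinearMap.rTensor Y (F i) s = LinearMap.rTensor Y (F i) t) : s = t := by
  refine eq_of_slice fun ω => sub_eq_zero.mp <| hF _ fun i => ?_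
  rw [map_sub, ← slice_rTensor, ← slice_rTensor, h, sub_self]

theorem eq_of_lTensor (F : ι → Y →ₗ[ℂ] Z) (hF : ∀ y, (∀ i, F i y = 0) → y = 0) {s t : X ⊗[ℂ] Y}
    (h : ∀ i, LinearMap.lTensor X (F i) s = LinearMap.lTensor X (F i) t) : s = t := by
  refine eq_of_lslice fun ω => sub_eq_zero.mp <| hF _ fun i => ?_
  rw [map_sub, ← lslice_lTensor, ← lslice_lTensor, h, sub_self]

end TensorSlices

section Algebra

variable {A : Type*} [NonUnitalRing A]

theorem IsNondegenerate.eq_of_mul_right (hA : IsNondegenerate A) {a b : A}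
    (h : ∀ x, a * x = b * x) : a = b :=
  sub_eq_zero.mp <| hA.1 _ fun x => by rw [sub_mul, h, sub_self]

theorem IsNondegenerate.eq_of_mul_left (hA : IsNondegenerate A) {a b : A}
    (h : ∀ x, x * a = x * b) : a = b :=
  sub_eq_zero.mp <| hA.2 _ fun x => by rw [mul_sub, h, sub_self]

variable [Module ℂ A] {Y : Type*} [AddCommGroup Y] [Module ℂ Y]

theorem IsNondegenerate.eq_of_rTensor_mulLeft [SMulCommClass ℂ A A] (hA : IsNondegenerate A)
    {s t : A ⊗[ℂ] Y}
    (h : ∀ a, LinearMap.rTensor Y (LinearMap.mulLeft ℂ a) s =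
      LinearMap.rTensor Y (LinearMap.mulLeft ℂ a) t) : s = t :=
  eq_of_rTensor (fun a : A => LinearMap.mulLeft ℂ a) hA.2 h

variable [IsScalarTower ℂ A A]

theorem IsNondegenerate.eq_of_rTensor_mulRight (hA : IsNondegenerate A) {s t : A ⊗[ℂ] Y}
    (h : ∀ a, LinearMap.rTensor Y (LinearMap.mulRight ℂ a) s =
      LinearMap.rTensor Y (LinearMap.mulRight ℂ a) t) : s = t :=
  eq_of_rTensor (fun a : A => LinearMap.mulRight ℂ a) hA.1 h

theorem IsNondegenerate.eq_of_lTensor_mulRight (hA : IsNondegenerate A) {s t : Y ⊗[ℂ] A}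
    (h : ∀ a, LinearMap.lTensor Y (LinearMap.mulRight ℂ a) s =
      LinearMap.lTensor Y (LinearMap.mulRight ℂ a) t) : s = t :=
  eq_of_lTensor (fun a : A => LinearMap.mulRight ℂ a) hA.1 h

variable [SMulCommClass ℂ A A]

@[simp] theorem Multiplier.left_zero : left (0 : Multiplier A) = 0 := rfl

theorem Multiplier.left_right_comm (hA : IsNondegenerate A) (m n : Multiplier A) (x : A) :
    left m (right n x) = right n (left m x) :=
  hA.eq_of_mul_left fun z => by
    rw [← central, ← right_mul_left hA, ← right_mul_left hA, central]

theorem Multiplier.ext_right (hA : IsNondegenerate A) {m n : Multiplier A}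
    (h : ∀ x, right m x = right n x) : m = n :=
  ext' (fun x => hA.eq_of_mul_left fun y => by rw [← central, ← central, h]) h

end Algebra

section Extension

variable {P : Type*} [NonUnitalRing P] [Module ℂ P]
variable {Q : Type*} [NonUnitalRing Q] [Module ℂ Q] [IsScalarTower ℂ Q Q] [SMulCommClass ℂ Q Q]

theorem IsNondegenerateHom.induction {γ : P →ₙₐ[ℂ] Multiplier Q} (hγ : IsNondegenerateHom γ)
    {p : Q → Prop} (zero : p 0) (add : ∀ x y, p x → p y → p (x + y))
    (act : ∀ a x, p (left (γ a) x)) (x : Q) : p x := by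
  have hx : x ∈ Submodule.span ℂ {y : Q | ∃ p x, y = left (γ p) x} := hγ.1 ▸ Submodule.mem_top
  induction hx using Submodule.closure_induction with
  | zero => exact zero
  | add x y _ _ hx hy => exact add x y hx hy
  | smul_mem r x hx =>
    obtain ⟨a, y, rfl⟩ := hx
    simpa using act (r • a) y

theorem IsNondegenerateHom.eq_of_left {γ : P →ₙₐ[ℂ] Multiplier Q} (hγ : IsNondegenerateHom γ)
    (hQ : IsNondegenerate Q) {x y : Q} (h : ∀ a, left (γ a) x = left (γ a) y) : x = y := by
  refine hQ.eq_of_mul_left fun z => ?_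
  suffices LinearMap.mulRight ℂ x = LinearMap.mulRight ℂ y from LinearMap.congr_fun this z
  refine LinearMap.ext_on hγ.2 ?_
  rintro _ ⟨a, z, rfl⟩
  simp only [LinearMap.mulRight_apply, central, h]

theorem IsNondegenerateHom.eq_of_mul {γ : P →ₙₐ[ℂ] Multiplier Q} (hγ : IsNondegenerateHom γ)
    (hQ : IsNondegenerate Q) {m n : Multiplier Q} (h : ∀ a, m * γ a = n * γ a) : m = n := by
  suffices left m = left n from ext_left hQ (LinearMap.congr_fun this)
  refine LinearMap.ext_on hγ.1 ?_
  rintro _ ⟨a, x, rfl⟩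
  rw [← left_mul, h, left_mul]

variable [IsScalarTower ℂ P P] [SMulCommClass ℂ P P]

theorem ofHom_nondegenerate (h : Function.Surjective (LinearMap.mul' ℂ P)) :
    IsNondegenerateHom (ofHom P) := by
  constructor <;>
    refine Submodule.eq_top_iff'.2 (map_mem_of_surjective h LinearMap.id fun x y => ?_)
  · exact Submodule.subset_span ⟨x, y, rfl⟩
  · exact Submodule.subset_span ⟨y, x, rfl⟩

theorem left_extend (hQ : IsNondegenerate Q) {γ : P →ₙₐ[ℂ] Multiplier Q}
    (hγ : IsNondegenerateHom γ) (m : Multiplier P) (p : P) (x : Q) :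
    left (extend γ m) (left (γ p) x) = left (γ (left m p)) x := by
  rw [← left_mul, (extend_spec hQ hγ m p).1]

variable {R : Type*} [NonUnitalRing R] [Module ℂ R] [IsScalarTower ℂ R R] [SMulCommClass ℂ R R]

theorem slice_left_tensorHom_ofHom (γ : P →ₙₐ[ℂ] Multiplier Q) (ω : R →ₗ[ℂ] ℂ) (t : P ⊗[ℂ] R)
    (z : Q) (x : R) : slice ω (left (tensorHom γ (ofHom R) t) (z ⊗ₜ x)) =
      left (γ (slice (ω ∘ₗ LinearMap.mulRight ℂ x) t)) z := by
  induction t with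
  | zero => simp
  | add s t hs ht => simp only [map_add, left_add, LinearMap.add_apply, hs, ht]
  | tmul p r => simp

theorem lslice_left_tensorHom_ofHom (γ : P →ₙₐ[ℂ] Multiplier Q) (ω : R →ₗ[ℂ] ℂ) (t : R ⊗[ℂ] P)
    (x : R) (z : Q) : lslice ω (left (tensorHom (ofHom R) γ t) (x ⊗ₜ z)) =
      left (γ (lslice (ω ∘ₗ LinearMap.mulRight ℂ x) t)) z := by
  induction t with
  | zero => simp
  | add s t hs ht => simp only [map_add, left_add, LinearMap.add_apply, hs, ht]
  | tmul r p => simp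

theorem tmul_one_mul_tensorHom_ofHom (γ : P →ₙₐ[ℂ] Multiplier Q) (p : P) (t : P ⊗[ℂ] R) :
    tmul (γ p) 1 * tensorHom γ (ofHom R) t =
      tensorHom γ (ofHom R) (LinearMap.rTensor R (LinearMap.mulLeft ℂ p) t) := by
  induction t with
  | zero => simp
  | add s t hs ht => simp only [map_add, mul_add, hs, ht]
  | tmul x y => simp [tmul_mul_tmul]

end Extension

namespace RegularMultiplierHopfAlgebra

variable {A : Type u} [NonUnitalRing A] [Module ℂ A] [IsScalarTower ℂ A A] [SMulCommClass ℂ A A]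
variable (H : RegularMultiplierHopfAlgebra A)

theorem left_Δ_T₁ (x : A) (s : A ⊗[ℂ] A) :
    left (H.Δ x) (H.T₁ s) = H.T₁ (LinearMap.rTensor A (LinearMap.mulLeft ℂ x) s) := by
  induction s with
  | zero => simp
  | add s t hs ht => simp only [map_add, hs, ht]
  | tmul p q =>
    apply of_injective H.nondeg2
    simp only [LinearMap.rTensor_tmul, LinearMap.mulLeft_apply, ← mul_of H.nondeg2, H.T₁_spec,
      map_mul, mul_assoc]

theorem right_Δ_T₂ (y : A) (s : A ⊗[ℂ] A) :
    right (H.Δ y) (H.T₂ s) = H.T₂ (LinearMap.lTensor A (LinearMap.mulRight ℂ y) s) := by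
  induction s <;> simp_all [H.right_T₂]

theorem right_Δ_T₄ (y : A) (s : A ⊗[ℂ] A) :
    right (H.Δ y) (H.T₄ s) = H.T₄ (LinearMap.lTensor A (LinearMap.mulRight ℂ y) s) := by
  induction s with
  | zero => simp
  | add s t hs ht => simp only [map_add, hs, ht]
  | tmul p q =>
    apply of_injective H.nondeg2
    simp only [LinearMap.lTensor_tmul, LinearMap.mulRight_apply, ← of_mul H.nondeg2, H.T₄_spec,
      map_mul, mul_assoc]

theorem left_Δ_tmul_eq_T₁ (a c d : A) : left (H.Δ a) (c ⊗ₜ d) =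
    LinearMap.rTensor A (LinearMap.mulRight ℂ c) (H.T₁ (a ⊗ₜ d)) :=
  (H.mulRight_T₁ a c d).symm

theorem left_Δ_tmul_eq_T₃ (a c d : A) : left (H.Δ a) (c ⊗ₜ d) =
    LinearMap.lTensor A (LinearMap.mulRight ℂ d) (H.T₃ (a ⊗ₜ c)) := by
  apply of_injective H.nondeg2
  refine Eq.trans ?_ (of_mul H.nondeg2 (tmul 1 (of d)) (H.T₃ (a ⊗ₜ c)))
  rw [← mul_of H.nondeg2, of_tmul, H.T₃_spec, mul_assoc, tmul_mul_tmul, one_mul, mul_one]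

theorem right_Δ_tmul_eq_T₂ (p q y : A) : right (H.Δ y) (p ⊗ₜ q) =
    LinearMap.lTensor A (LinearMap.mulLeft ℂ q) (H.T₂ (p ⊗ₜ y)) :=
  H.right_tmul_eq p q y

theorem right_Δ_tmul_eq_T₄ (p q y : A) : right (H.Δ y) (p ⊗ₜ q) =
    LinearMap.rTensor A (LinearMap.mulLeft ℂ p) (H.T₄ (q ⊗ₜ y)) := by
  apply of_injective H.nondeg2
  refine Eq.trans ?_ (mul_of H.nondeg2 (tmul (of p) 1) (H.T₄ (q ⊗ₜ y)))
  rw [← of_mul H.nondeg2, of_tmul, H.T₄_spec, ← mul_assoc, tmul_mul_tmul, one_mul, mul_one]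

theorem lTensor_mulRight_T₄ (q y z : A) :
    LinearMap.lTensor A (LinearMap.mulRight ℂ z) (H.T₄ (q ⊗ₜ y)) =
      LinearMap.lTensor A (LinearMap.mulLeft ℂ q) (H.T₁ (y ⊗ₜ z)) := by
  apply of_injective H.nondeg2
  calc of (right (tmul 1 (of z)) (H.T₄ (q ⊗ₜ y)))
      = tmul 1 (of q) * (H.Δ y * tmul 1 (of z)) := by
        rw [← of_mul H.nondeg2, H.T₄_spec, mul_assoc]
    _ = of (left (tmul 1 (of q)) (H.T₁ (y ⊗ₜ z))) := by rw [← H.T₁_spec, mul_of H.nondeg2]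

theorem rTensor_mulRight_T₄ (q y z : A) :
    LinearMap.rTensor A (LinearMap.mulRight ℂ z) (H.T₄ (q ⊗ₜ y)) =
      LinearMap.lTensor A (LinearMap.mulLeft ℂ q) (H.T₃ (y ⊗ₜ z)) := by
  apply of_injective H.nondeg2
  calc of (right (tmul (of z) 1) (H.T₄ (q ⊗ₜ y)))
      = tmul 1 (of q) * (H.Δ y * tmul (of z) 1) := by
        rw [← of_mul H.nondeg2, H.T₄_spec, mul_assoc]
    _ = of (left (tmul 1 (of q)) (H.T₃ (y ⊗ₜ z))) := by rw [← H.T₃_spec, mul_of H.nondeg2]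

theorem rTensor_mulRight_T₂ (p y z : A) :
    LinearMap.rTensor A (LinearMap.mulRight ℂ z) (H.T₂ (p ⊗ₜ y)) =
      LinearMap.rTensor A (LinearMap.mulLeft ℂ p) (H.T₃ (y ⊗ₜ z)) :=
  H.mulRight_T₂ p y z

theorem rTensor_mulLeft_T₁ (e a c : A) :
    LinearMap.rTensor A (LinearMap.mulLeft ℂ e) (H.T₁ (a ⊗ₜ c)) =
      LinearMap.lTensor A (LinearMap.mulRight ℂ c) (H.T₂ (e ⊗ₜ a)) :=
  H.mulLeft_T₁ e a c

theorem lTensor_mulLeft_T₂ (p q y : A) :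
    LinearMap.lTensor A (LinearMap.mulLeft ℂ q) (H.T₂ (p ⊗ₜ y)) =
      LinearMap.rTensor A (LinearMap.mulLeft ℂ p) (H.T₄ (q ⊗ₜ y)) :=
  (H.right_Δ_tmul_eq_T₂ p q y).symm.trans (H.right_Δ_tmul_eq_T₄ p q y)

theorem lTensor_mulRight_T₃ (a c d : A) :
    LinearMap.lTensor A (LinearMap.mulRight ℂ d) (H.T₃ (a ⊗ₜ c)) =
      LinearMap.rTensor A (LinearMap.mulRight ℂ c) (H.T₁ (a ⊗ₜ d)) :=
  (H.left_Δ_tmul_eq_T₃ a c d).symm.trans (H.left_Δ_tmul_eq_T₁ a c d)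

/-- `f : A → A` commutes with the left coaction `Δ` of `A` on itself, that is, `(ι ⊗ f)Δ = Δ f`;
the multiplication by `p ⊗ 1` from the left keeps the identity in `A ⊗ A`. -/
def IsColinear (f : A →ₗ[ℂ] A) : Prop :=
  ∀ p x, LinearMap.lTensor A f (H.T₂ (p ⊗ₜ x)) = H.T₂ (p ⊗ₜ f x)

namespace IsColinear

variable {H} {f : A →ₗ[ℂ] A}

theorem lTensor_T₂ (hf : H.IsColinear f) (s : A ⊗[ℂ] A) :
    LinearMap.lTensor A f (H.T₂ s) = H.T₂ (LinearMap.lTensor A f s) := by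
  induction s with
  | zero => simp
  | add s t hs ht => simp only [map_add, hs, ht]
  | tmul p x => exact hf p x

theorem lTensor_T₃ (hf : H.IsColinear f) (s : A ⊗[ℂ] A) :
    LinearMap.lTensor A f (H.T₃ s) = H.T₃ (LinearMap.rTensor A f s) := by
  have swap (g : A →ₗ[ℂ] A) (t : A ⊗[ℂ] A) : LinearMap.rTensor A g (LinearMap.lTensor A f t) =
      LinearMap.lTensor A f (LinearMap.rTensor A g t) := by
    rw [← LinearMap.comp_apply, ← LinearMap.comp_apply, LinearMap.rTensor_comp_lTensor,
      LinearMap.lTensor_comp_rTensor]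
  induction s with
  | zero => simp
  | add s t hs ht => simp only [map_add, hs, ht]
  | tmul y z =>
    refine H.nondegenerate.eq_of_rTensor_mulLeft fun p => ?_
    rw [swap, ← H.rTensor_mulRight_T₂, ← swap, hf, LinearMap.rTensor_tmul, H.rTensor_mulRight_T₂]

end IsColinear

theorem isColinear_slice_T₁ (ω : A →ₗ[ℂ] ℂ) (c : A) :
    H.IsColinear (slice ω ∘ₗ H.T₁.toLinearMap ∘ₗ (TensorProduct.mk ℂ A A).flip c) := by
  intro p q
  have h := congrArg (slice ω) (H.coassoc p q c)
  rw [slice_rTensor, slice_assoc_symm, slice_assoc_symm, assoc_tmul_eq_lTensor,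
    ← LinearMap.lTensor_comp_apply, ← LinearMap.lTensor_comp_apply] at h
  exact h.symm

theorem isColinear_slice_T₄ (ω : A →ₗ[ℂ] ℂ) (x : A) :
    H.IsColinear (slice ω ∘ₗ H.T₄.toLinearMap ∘ₗ TensorProduct.mk ℂ A A x) := by
  intro p q
  have slice_T₄ (ω : A →ₗ[ℂ] ℂ) (c y : A) : slice (ω ∘ₗ LinearMap.mulRight ℂ c) (H.T₄ (x ⊗ₜ y)) =
      slice (ω ∘ₗ LinearMap.mulLeft ℂ x) (H.T₁ (y ⊗ₜ c)) := by
    rw [← slice_lTensor, H.lTensor_mulRight_T₄, slice_lTensor]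
  have coassoc_T₄ : (TensorProduct.assoc ℂ A A A).symm
        (LinearMap.lTensor A (H.T₄.toLinearMap ∘ₗ TensorProduct.mk ℂ A A x) (H.T₂ (p ⊗ₜ q))) =
      LinearMap.rTensor A (H.T₂.toLinearMap ∘ₗ TensorProduct.mk ℂ A A p) (H.T₄ (x ⊗ₜ q)) := by
    refine H.nondegenerate.eq_of_lTensor_mulRight fun c => eq_of_slice fun ω => ?_
    rw [slice_lTensor, slice_lTensor, slice_assoc_symm, slice_rTensor, slice_T₄,
      ← LinearMap.lTensor_comp_apply]
    refine Eq.trans ?_ (H.isColinear_slice_T₁ (ω ∘ₗ LinearMap.mulLeft ℂ x) c p q)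
    congr 2
    ext y
    exact slice_T₄ ω c y
  rw [LinearMap.lTensor_comp_apply, ← slice_assoc_symm, coassoc_T₄, slice_rTensor]
  rfl

section Counit

theorem lTensor_mul'_T₁_symm (s : A ⊗[ℂ] A) (b : A) :
    LinearMap.lTensor A (LinearMap.mul' ℂ A ∘ₗ H.T₁.symm.toLinearMap)
      (TensorProduct.assoc ℂ A A A (H.T₂ s ⊗ₜ b)) = LinearMap.mul' ℂ A s ⊗ₜ b := by
  have mul_leg_two (t : A ⊗[ℂ] A) (c : A) : LinearMap.lTensor A (LinearMap.mul' ℂ A)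
      (TensorProduct.assoc ℂ A A A (t ⊗ₜ c)) = LinearMap.lTensor A (LinearMap.mulRight ℂ c) t := by
    rw [assoc_tmul_eq_lTensor, ← LinearMap.lTensor_comp_apply]
    rfl
  have cancel_T₁ (c : A) (t : A ⊗[ℂ] A) :
      LinearMap.lTensor A (LinearMap.mul' ℂ A ∘ₗ H.T₁.symm.toLinearMap)
        (TensorProduct.assoc ℂ A A A (LinearMap.rTensor A H.T₂.toLinearMap
          ((TensorProduct.assoc ℂ A A A).symm (c ⊗ₜ t)))) =
      LinearMap.rTensor A (LinearMap.mulLeft ℂ c) t := by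
    obtain ⟨t, rfl⟩ := H.T₁.surjective t
    induction t with
    | zero => simp
    | add s t hs ht => simp only [TensorProduct.tmul_add, map_add, hs, ht]
    | tmul p q =>
      rw [H.coassoc, LinearEquiv.apply_symm_apply, ← LinearMap.lTensor_comp_apply,
        LinearMap.comp_assoc, LinearEquiv.symm_comp, LinearMap.comp_id, mul_leg_two,
        H.rTensor_mulLeft_T₁]
  induction s with
  | zero => simp
  | add s t hs ht => simp only [TensorProduct.add_tmul, map_add, hs, ht]
  | tmul p q => simpa using cancel_T₁ p (q ⊗ₜ b)

theorem exists_counit : ∃ ε : A →ₗ[ℂ] ℂ,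
    (∀ a b : A, LinearMap.mul' ℂ A (H.T₁.symm (a ⊗ₜ b)) = ε a • b) ∧
    ∀ a b : A, LinearMap.mul' ℂ A (H.T₂.symm (a ⊗ₜ b)) = ε b • a := by
  rcases subsingleton_or_nontrivial A with _ | _
  · exact ⟨0, fun _ _ => Subsingleton.elim _ _, fun _ _ => Subsingleton.elim _ _⟩
  obtain ⟨x₀, hx₀⟩ := exists_ne (0 : A)
  obtain ⟨χ, hχ⟩ := Module.Projective.exists_dual_eq_one ℂ hx₀
  have comparison (x y b : A) : x ⊗ₜ[ℂ] LinearMap.mul' ℂ A (H.T₁.symm (y ⊗ₜ b)) =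
      LinearMap.mul' ℂ A (H.T₂.symm (x ⊗ₜ y)) ⊗ₜ[ℂ] b := by
    simpa using H.lTensor_mul'_T₁_symm (H.T₂.symm (x ⊗ₜ y)) b
  have eq_T₁ (y b : A) : LinearMap.mul' ℂ A (H.T₁.symm (y ⊗ₜ b)) =
      χ (LinearMap.mul' ℂ A (H.T₂.symm (x₀ ⊗ₜ y))) • b := by
    simpa [hχ] using congrArg (lslice χ) (comparison x₀ y b)
  refine ⟨χ ∘ₗ LinearMap.mul' ℂ A ∘ₗ H.T₂.symm.toLinearMap ∘ₗ TensorProduct.mk ℂ A A x₀,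
    eq_T₁, fun a b => ?_⟩
  simpa [eq_T₁, hχ] using (congrArg (slice χ) (comparison a b x₀)).symm

/-- The counit `ε`, characterized by `(ε ⊗ ι)(Δ(a)(1 ⊗ b)) = ab` and
`(ι ⊗ ε)((a ⊗ 1)Δ(b)) = ab`. -/
def counit : A →ₗ[ℂ] ℂ := H.exists_counit.choose

theorem lslice_counit_T₁ (s : A ⊗[ℂ] A) :
    lslice H.counit (H.T₁ s) = LinearMap.mul' ℂ A s := by
  obtain ⟨t, rfl⟩ := H.T₁.symm.surjective s
  rw [LinearEquiv.apply_symm_apply]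
  induction t with
  | zero => simp
  | add s t hs ht => simp only [map_add, hs, ht]
  | tmul a b => rw [lslice_tmul]; exact (H.exists_counit.choose_spec.1 a b).symm

theorem slice_counit_T₂ (s : A ⊗[ℂ] A) :
    slice H.counit (H.T₂ s) = LinearMap.mul' ℂ A s := by
  obtain ⟨t, rfl⟩ := H.T₂.symm.surjective s
  rw [LinearEquiv.apply_symm_apply]
  induction t with
  | zero => simp
  | add s t hs ht => simp only [map_add, hs, ht]
  | tmul a b => rw [slice_tmul]; exact (H.exists_counit.choose_spec.2 a b).symm

theorem slice_counit_T₃ (s : A ⊗[ℂ] A) :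
    slice H.counit (H.T₃ s) = LinearMap.mul' ℂ A s := by
  induction s with
  | zero => simp
  | add s t hs ht => simp only [map_add, hs, ht]
  | tmul y z =>
    refine H.nondegenerate.eq_of_mul_left fun p => ?_
    have h := congrArg (slice H.counit) (H.rTensor_mulRight_T₂ p y z)
    rw [slice_rTensor, slice_rTensor, slice_counit_T₂] at h
    simpa [mul_assoc] using h.symm

theorem lslice_counit_T₄ (s : A ⊗[ℂ] A) :
    lslice H.counit (H.T₄ s) = LinearMap.mul' ℂ A s := by
  induction s with
  | zero => simp
  | add s t hs ht => simp only [map_add, hs, ht]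
  | tmul q y =>
    refine H.nondegenerate.eq_of_mul_right fun z => ?_
    have h := congrArg (lslice H.counit) (H.lTensor_mulRight_T₄ q y z)
    rw [lslice_lTensor, lslice_lTensor, lslice_counit_T₁] at h
    simpa [mul_assoc] using h

theorem lslice_counit_left_Δ (x : A) (t : A ⊗[ℂ] A) :
    lslice H.counit (left (H.Δ x) t) = x * lslice H.counit t := by
  obtain ⟨t, rfl⟩ := H.T₁.surjective t
  rw [left_Δ_T₁, lslice_counit_T₁, lslice_counit_T₁]
  induction t <;> simp_all [mul_add, mul_assoc]

theorem counit_mul (a b : A) : H.counit (a * b) = H.counit a * H.counit b := by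
  rcases subsingleton_or_nontrivial A with _ | _
  · simp [Subsingleton.elim a 0]
  have lslice_mulRight (t : A ⊗[ℂ] A) :
      lslice (H.counit ∘ₗ LinearMap.mulRight ℂ b) t = H.counit b • lslice H.counit t := by
    obtain ⟨t, rfl⟩ := H.T₁.surjective t
    induction t with
    | zero => simp
    | add s t hs ht => simp only [map_add, smul_add, hs, ht]
    | tmul p q =>
      rw [← lslice_rTensor, ← H.left_Δ_tmul_eq_T₁, lslice_counit_left_Δ, lslice_counit_T₁]
      simp [mul_smul_comm]
  obtain ⟨y, hy⟩ := exists_ne (0 : A)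
  refine smul_left_injective ℂ hy ?_
  simpa [smul_smul, mul_comm] using lslice_mulRight (a ⊗ₜ y)

theorem mul'_surjective (H : RegularMultiplierHopfAlgebra A) :
    Function.Surjective (LinearMap.mul' ℂ A) := by
  intro a
  by_cases hε : H.counit = 0
  · refine ⟨0, (H.nondegenerate.1 a fun y => ?_).symm ▸ map_zero _⟩
    simpa [hε, lslice] using (H.lslice_counit_T₁ (a ⊗ₜ y)).symm
  · obtain ⟨t, rfl⟩ := lslice_surjective (Y := A) hε a
    exact ⟨H.T₁.symm t, by rw [← lslice_counit_T₁, LinearEquiv.apply_symm_apply]⟩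

end Counit

end RegularMultiplierHopfAlgebra

namespace AlgebraicQuantumGroup

variable {A : Type u} [NonUnitalRing A] [Module ℂ A] [IsScalarTower ℂ A A] [SMulCommClass ℂ A A]
variable (H : AlgebraicQuantumGroup A)

section Separation

theorem isColinear_act (b : H.Dual) : H.IsColinear (H.act b) := H.lTensor_act b

theorem toDual_mul (c c' : A) : H.toDual c * H.toDual c' =
    H.toDual (slice H.φ (H.T₃.symm (c ⊗ₜ c'))) := by
  refine H.dual_ext fun x => ?_
  rw [eval_mul, eval_toDual, H.act_mul _ x c c' (LinearEquiv.apply_symm_apply _ _), eval_toDual]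
  induction H.T₃.symm (c ⊗ₜ c') with
  | zero => simp
  | add s t hs ht => simp only [map_add, mul_add, hs, ht]
  | tmul p q => simp [mul_comm, mul_smul_comm]

theorem dual_mul'_surjective : Function.Surjective (LinearMap.mul' ℂ H.Dual) := by
  intro b
  obtain ⟨d, rfl⟩ := H.toDual_surjective b
  obtain ⟨s, rfl⟩ := slice_surjective (X := A) H.φ_ne_zero d
  have mul'_map (t : A ⊗[ℂ] A) : LinearMap.mul' ℂ H.Dual (TensorProduct.map H.toDual H.toDual t) =
      H.toDual (slice H.φ (H.T₃.symm t)) := by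
    induction t with
    | zero => simp
    | add s t hs ht => simp only [map_add, hs, ht]
    | tmul p q => simp [toDual_mul]
  exact ⟨_, by rw [mul'_map, LinearEquiv.symm_apply_apply]⟩

theorem act_eq_zero_of_eval {n : A} (h : ∀ b, H.eval b n = 0) (b : H.Dual) : H.act b n = 0 := by
  obtain ⟨c', rfl⟩ := H.toDual_surjective b
  refine H.nondegenerate.1 _ fun c => ?_
  have functional_eq_zero : H.φ ∘ₗ LinearMap.mulLeft ℂ n = 0 :=
    LinearMap.ext fun x => h (H.toDual x)
  simp [H.act_mul _ n c c' (LinearEquiv.apply_symm_apply _ _), functional_eq_zero]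

theorem eval_eq_zero_of_act {n : A} (h : ∀ b, H.act b n = 0) (b : H.Dual) : H.eval b n = 0 := by
  obtain ⟨t, rfl⟩ := H.dual_mul'_surjective b
  induction t with
  | zero => simp
  | add s t hs ht => simp only [map_add, LinearMap.add_apply, hs, ht, add_zero]
  | tmul b b' => simp [h]

theorem counit_eq_zero_of_act {n : A} (h : ∀ b, H.act b n = 0) : H.counit n = 0 := by
  obtain ⟨u, hu⟩ := LinearMap.surjective H.φ_ne_zero 1
  obtain ⟨s, hs⟩ := H.T₃.surjective (u ⊗ₜ n)
  obtain ⟨s, rfl⟩ := mem_range_rTensor_iInf_ker (fun b => H.act b) (t := s) fun b => by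
    rw [← H.T₃.map_eq_zero_iff, ← (H.isColinear_act b).lTensor_T₃, hs, LinearMap.lTensor_tmul, h,
      TensorProduct.tmul_zero]
  have φ_mul' : H.φ (LinearMap.mul' ℂ A (LinearMap.rTensor A
      (⨅ b, LinearMap.ker (H.act b)).subtype s)) = 0 := by
    clear hs
    induction s with
    | zero => simp
    | add s t hs ht => simp only [map_add, hs, ht, add_zero]
    | tmul x y =>
      exact H.eval_eq_zero_of_act (fun b => (Submodule.mem_iInf _).1 x.2 b) (H.toDual y)
  rw [← H.slice_counit_T₃, hs] at φ_mul'
  simpa [hu] using φ_mul'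

theorem eq_zero_of_act {n : A} (h : ∀ b, H.act b n = 0) : n = 0 := by
  refine H.nondegenerate.1 n fun z => ?_
  obtain ⟨s, hs⟩ := mem_range_lTensor_iInf_ker (fun b => H.act b) (t := H.T₃ (n ⊗ₜ z)) fun b => by
    rw [(H.isColinear_act b).lTensor_T₃, LinearMap.rTensor_tmul, h, TensorProduct.zero_tmul,
      map_zero]
  have counit_comp_subtype : H.counit ∘ₗ (⨅ b, LinearMap.ker (H.act b)).subtype = 0 :=
    LinearMap.ext fun x => H.counit_eq_zero_of_act fun b => (Submodule.mem_iInf _).1 x.2 b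
  have h := H.slice_counit_T₃ (n ⊗ₜ z)
  rw [← hs, slice_lTensor, counit_comp_subtype] at h
  simpa [slice] using h.symm

theorem eq_zero_of_eval {n : A} (h : ∀ b, H.eval b n = 0) : n = 0 :=
  H.eq_zero_of_act (H.act_eq_zero_of_eval h)

theorem eq_of_eval {m n : A} (h : ∀ b, H.eval b m = H.eval b n) : m = n :=
  sub_eq_zero.mp <| H.eq_zero_of_eval fun b => by rw [map_sub, h, sub_self]

/-- The map `x ⊗ z ↦ (ι ⊗ φ)(Δ(x)(1 ⊗ z))`. -/
def sliceT₁ : A ⊗[ℂ] A →ₗ[ℂ] A := slice H.φ ∘ₗ H.T₁.toLinearMap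

theorem sliceT₁_surjective : Function.Surjective H.sliceT₁ :=
  (slice_surjective H.φ_ne_zero).comp H.T₁.surjective

theorem sliceT₁_tmul (x z : A) : H.sliceT₁ (x ⊗ₜ z) = H.act (H.toDual z) x :=
  (H.act_toDual z x).symm

theorem span_act_eq_top : Submodule.span ℂ {y | ∃ b x, y = H.act b x} = ⊤ :=
  Submodule.eq_top_iff'.2 <| map_mem_of_surjective H.sliceT₁_surjective LinearMap.id
    fun x z => Submodule.subset_span ⟨_, _, H.sliceT₁_tmul x z⟩

theorem eq_zero_of_act_eq_zero {b : H.Dual} (h : ∀ a, H.act b a = 0) : b = 0 := by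
  obtain ⟨u, hu⟩ := LinearMap.surjective H.φ_ne_zero 1
  have slice_T₂ (t : A ⊗[ℂ] A) : slice (H.eval b) (H.T₂ t) = 0 := by
    induction t with
    | zero => simp
    | add s t hs ht => simp only [map_add, hs, ht, add_zero]
    | tmul p q => rw [← mul_act, h, mul_zero]
  refine H.dual_ext fun a => ?_
  simpa [hu] using congrArg H.φ (slice_T₂ (H.T₂.symm (u ⊗ₜ a)))

theorem dual_nondegenerate : IsNondegenerate H.Dual := by
  refine ⟨fun b hb => H.eval_injective (LinearMap.ext_on H.span_act_eq_top ?_), fun b hb =>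
    H.eq_zero_of_act_eq_zero fun a => H.eq_zero_of_eval fun b' => ?_⟩
  · rintro _ ⟨b', x, rfl⟩
    rw [← eval_mul, hb]
    simp
  · rw [← eval_mul, hb, map_zero, LinearMap.zero_apply]

theorem heisenberg_nondegenerate : IsNondegenerate H.Heisenberg := by
  refine ⟨fun s hs => H.heisAct_injective s fun a => ?_,
    fun s hs => H.heisAct_injective s fun a => H.eq_zero_of_act fun b =>
      H.nondegenerate.2 _ fun p => ?_⟩
  · have heisAct_mulLeft (p : A) : H.heisAct s ∘ₗ LinearMap.mulLeft ℂ p = 0 := by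
      refine LinearMap.ext_on H.span_act_eq_top ?_
      rintro _ ⟨b, x, rfl⟩
      simpa [hs] using (H.heisAct_mul s (H.heis p b) x).symm
    obtain ⟨t, rfl⟩ := H.mul'_surjective a
    induction t with
    | zero => simp
    | add t t' ht ht' => simp only [map_add, ht, ht', add_zero]
    | tmul p q => exact LinearMap.congr_fun (heisAct_mulLeft p) q
  · rw [← heisAct_heis, ← heisAct_mul, hs, map_zero, LinearMap.zero_apply]

end Separation

section Antipode

/-- The map `x ⊗ z ↦ (ι ⊗ φ)((1 ⊗ x)Δ(z))`. -/
def sliceT₄ : A ⊗[ℂ] A →ₗ[ℂ] A := slice H.φ ∘ₗ H.T₄.toLinearMap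

theorem sliceT₄_surjective : Function.Surjective H.sliceT₄ :=
  (slice_surjective H.φ_ne_zero).comp H.T₄.surjective

theorem isColinear_sliceT₄ (x : A) : H.IsColinear (H.sliceT₄ ∘ₗ TensorProduct.mk ℂ A A x) :=
  H.isColinear_slice_T₄ H.φ x

theorem sliceT₁_mul (x z u : A) : H.sliceT₁ (x ⊗ₜ z) * u =
    lslice (H.φ ∘ₗ LinearMap.mulLeft ℂ x) (H.T₃.symm (u ⊗ₜ z)) := by
  rw [sliceT₁_tmul]
  exact H.act_mul _ x u z (LinearEquiv.apply_symm_apply _ _)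

theorem slice_φ_T₂ (s : A ⊗[ℂ] A) : slice H.φ (H.T₂ s) = slice H.φ s := by
  induction s with
  | zero => simp
  | add s t hs ht => simp only [map_add, hs, ht]
  | tmul x a => rw [H.left_invariant', slice_tmul]

theorem slice_φ_right_Δ (x : A) (t : A ⊗[ℂ] A) : slice H.φ (right (H.Δ x) t) =
    slice (H.φ ∘ₗ LinearMap.mulRight ℂ x) (H.T₂.symm t) := by
  obtain ⟨s, rfl⟩ := H.T₂.surjective t
  rw [H.right_Δ_T₂, slice_φ_T₂, slice_lTensor, LinearEquiv.symm_apply_apply]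

theorem mul_sliceT₄ (x z u : A) : u * H.sliceT₄ (x ⊗ₜ z) =
    slice (H.φ ∘ₗ LinearMap.mulRight ℂ z) (H.T₂.symm (u ⊗ₜ x)) := by
  rw [← slice_φ_right_Δ, H.right_Δ_tmul_eq_T₄, slice_rTensor]
  rfl

theorem sliceT₄_mul (x z y : A) : H.sliceT₄ (x ⊗ₜ z) * y =
    slice (H.φ ∘ₗ LinearMap.mulLeft ℂ x) (H.T₃ (z ⊗ₜ y)) := by
  rw [← slice_lTensor, ← H.rTensor_mulRight_T₄, slice_rTensor]
  rfl

theorem lslice_counit_T₃_symm (u : A) (t : A ⊗[ℂ] A) :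
    lslice H.counit (H.T₃.symm (u ⊗ₜ H.sliceT₄ t)) = H.sliceT₁ t * u := by
  induction t with
  | zero => simp
  | add s t hs ht => simp only [map_add, TensorProduct.tmul_add, add_mul, hs, ht]
  | tmul x z =>
    have counit_sliceT₄ : H.counit ∘ₗ H.sliceT₄ ∘ₗ TensorProduct.mk ℂ A A x =
        H.φ ∘ₗ LinearMap.mulLeft ℂ x := LinearMap.ext fun q =>
      (apply_slice _ _ _).trans (congrArg H.φ (H.lslice_counit_T₄ (x ⊗ₜ q)))
    have T₃_symm_sliceT₄ : H.T₃.symm (u ⊗ₜ H.sliceT₄ (x ⊗ₜ z)) = LinearMap.rTensor A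
        (H.sliceT₄ ∘ₗ TensorProduct.mk ℂ A A x) (H.T₃.symm (u ⊗ₜ z)) := by
      rw [LinearEquiv.symm_apply_eq, ← (H.isColinear_sliceT₄ x).lTensor_T₃,
        LinearEquiv.apply_symm_apply]
      rfl
    rw [T₃_symm_sliceT₄, lslice_rTensor, counit_sliceT₄, sliceT₁_mul]

theorem slice_counit_T₂_symm (u : A) (t : A ⊗[ℂ] A) :
    slice H.counit (H.T₂.symm (u ⊗ₜ H.sliceT₁ t)) = u * H.sliceT₄ t := by
  induction t with
  | zero => simp
  | add s t hs ht => simp only [map_add, TensorProduct.tmul_add, mul_add, hs, ht]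
  | tmul x z =>
    have counit_act : H.counit ∘ₗ H.act (H.toDual z) = H.φ ∘ₗ LinearMap.mulRight ℂ z :=
      LinearMap.ext fun q => by
        rw [LinearMap.comp_apply, act_toDual, apply_slice, H.lslice_counit_T₁]
        rfl
    have T₂_symm_sliceT₁ : H.T₂.symm (u ⊗ₜ H.sliceT₁ (x ⊗ₜ z)) = LinearMap.lTensor A
        (H.act (H.toDual z)) (H.T₂.symm (u ⊗ₜ x)) := by
      rw [LinearEquiv.symm_apply_eq, ← (H.isColinear_act _).lTensor_T₂,
        LinearEquiv.apply_symm_apply, LinearMap.lTensor_tmul, sliceT₁_tmul]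
    rw [T₂_symm_sliceT₁, slice_lTensor, counit_act, mul_sliceT₄]

theorem ker_sliceT₁ : LinearMap.ker H.sliceT₁ = LinearMap.ker H.sliceT₄ := by
  ext t
  simp only [LinearMap.mem_ker]
  refine ⟨fun h => H.nondegenerate.2 _ fun u => ?_, fun h => H.nondegenerate.1 _ fun u => ?_⟩
  · rw [← slice_counit_T₂_symm, h, TensorProduct.tmul_zero, map_zero, map_zero]
  · rw [← lslice_counit_T₃_symm, h, TensorProduct.tmul_zero, map_zero, map_zero]

/-- The antipode `S`, characterized by `S((ι ⊗ φ)(Δ(x)(1 ⊗ z))) = (ι ⊗ φ)((1 ⊗ x)Δ(z))`. -/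
def antipode : A ≃ₗ[ℂ] A :=
  (H.sliceT₁.quotKerEquivOfSurjective H.sliceT₁_surjective).symm ≪≫ₗ
    Submodule.quotEquivOfEq _ _ H.ker_sliceT₁ ≪≫ₗ
    H.sliceT₄.quotKerEquivOfSurjective H.sliceT₄_surjective

@[simp] theorem antipode_sliceT₁ (t : A ⊗[ℂ] A) : H.antipode (H.sliceT₁ t) = H.sliceT₄ t := by
  have symm_sliceT₁ : (H.sliceT₁.quotKerEquivOfSurjective H.sliceT₁_surjective).symm
      (H.sliceT₁ t) = Submodule.Quotient.mk t := by
    rw [LinearEquiv.symm_apply_eq]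
    rfl
  simp only [antipode, LinearEquiv.trans_apply, symm_sliceT₁]
  rfl

theorem mul_antipode (u a : A) :
    u * H.antipode a = slice H.counit (H.T₂.symm (u ⊗ₜ a)) := by
  obtain ⟨t, rfl⟩ := H.sliceT₁_surjective a
  rw [antipode_sliceT₁, slice_counit_T₂_symm]

theorem antipode_mul (a b : A) : H.antipode (a * b) = H.antipode b * H.antipode a := by
  have slice_counit_mulLeft (s : A ⊗[ℂ] A) :
      slice H.counit (H.T₂.symm (LinearMap.lTensor A (LinearMap.mulLeft ℂ a) (H.T₂ s))) =
        slice H.counit s * H.antipode a := by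
    induction s with
    | zero => simp
    | add s t hs ht => simp only [map_add, add_mul, hs, ht]
    | tmul p q =>
      have counit_mulRight : H.counit ∘ₗ LinearMap.mulRight ℂ q = H.counit q • H.counit :=
        LinearMap.ext fun y => by simp [H.counit_mul, mul_comm]
      rw [← H.right_Δ_tmul_eq_T₂, ← H.T₂.apply_symm_apply (p ⊗ₜ a), H.right_Δ_T₂,
        LinearEquiv.symm_apply_apply, slice_lTensor, counit_mulRight, slice_tmul,
        smul_mul_assoc, mul_antipode]
      simp [slice]
  refine H.nondegenerate.eq_of_mul_left fun u => ?_
  rw [mul_antipode, ← mul_assoc, H.mul_antipode u b, ← slice_counit_mulLeft]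
  simp

theorem antipode_symm_mul (a b : A) :
    H.antipode.symm (a * b) = H.antipode.symm b * H.antipode.symm a := by
  rw [LinearEquiv.symm_apply_eq, antipode_mul, LinearEquiv.apply_symm_apply,
    LinearEquiv.apply_symm_apply]

theorem map_antipode_rTensor_mulLeft (e : A) (t : A ⊗[ℂ] A) :
    TensorProduct.map H.antipode.toLinearMap H.antipode.toLinearMap
      (LinearMap.rTensor A (LinearMap.mulLeft ℂ e) t) =
    LinearMap.rTensor A (LinearMap.mulRight ℂ (H.antipode e))
      (TensorProduct.map H.antipode.toLinearMap H.antipode.toLinearMap t) := by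
  induction t <;> simp_all [antipode_mul]

theorem map_antipode_lTensor_mulLeft (e : A) (t : A ⊗[ℂ] A) :
    TensorProduct.map H.antipode.toLinearMap H.antipode.toLinearMap
      (LinearMap.lTensor A (LinearMap.mulLeft ℂ e) t) =
    LinearMap.lTensor A (LinearMap.mulRight ℂ (H.antipode e))
      (TensorProduct.map H.antipode.toLinearMap H.antipode.toLinearMap t) := by
  induction t <;> simp_all [antipode_mul]

theorem map_antipode_T₄ (p a : A) :
    TensorProduct.map H.antipode.toLinearMap H.antipode.toLinearMap (H.T₄ (p ⊗ₜ a)) =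
      TensorProduct.comm ℂ A A (H.T₃ (H.antipode a ⊗ₜ H.antipode p)) := by
  obtain ⟨t, rfl⟩ := H.sliceT₁_surjective a
  induction t with
  | zero => simp
  | add s t hs ht => simp only [map_add, TensorProduct.tmul_add, TensorProduct.add_tmul, hs, ht]
  | tmul x z =>
    have antipode_mul_act (y : A) : H.antipode (p * H.act (H.toDual z) y) =
        slice (H.φ ∘ₗ LinearMap.mulLeft ℂ y) (H.T₃ (z ⊗ₜ H.antipode p)) := by
      rw [antipode_mul, ← sliceT₁_tmul, antipode_sliceT₁, sliceT₄_mul]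
    have sliceT₄_mul_antipode (e z' : A) : H.sliceT₄ (x ⊗ₜ z') * H.antipode e =
        H.antipode (slice (H.eval (H.toDual z')) (H.T₂ (e ⊗ₜ x))) := by
      rw [← antipode_sliceT₁, sliceT₁_tmul, ← antipode_mul, mul_act]
    have T₃_sliceT₄ : H.T₃ (H.sliceT₄ (x ⊗ₜ z) ⊗ₜ H.antipode p) = LinearMap.lTensor A
        (H.sliceT₄ ∘ₗ TensorProduct.mk ℂ A A x) (H.T₃ (z ⊗ₜ H.antipode p)) := by
      rw [(H.isColinear_sliceT₄ x).lTensor_T₃]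
      rfl
    refine H.nondegenerate.eq_of_rTensor_mulRight fun e' => eq_of_lslice fun χ => ?_
    obtain ⟨e, rfl⟩ := H.antipode.surjective e'
    rw [antipode_sliceT₁, T₃_sliceT₄, ← map_antipode_rTensor_mulLeft, ← H.lTensor_mulLeft_T₂,
      sliceT₁_tmul, ← H.isColinear_act, lslice_map, lslice_lTensor, lslice_lTensor,
      lslice_rTensor, lslice_comm, slice_lTensor]
    refine (antipode_mul_act _).trans (congrArg (slice · _) (LinearMap.ext fun z' => ?_))
    simp only [LinearMap.comp_apply, LinearMap.mulRight_apply, TensorProduct.mk_apply,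
      sliceT₄_mul_antipode]
    exact (apply_slice (χ ∘ₗ H.antipode.toLinearMap) (H.eval (H.toDual z')) _).symm

theorem map_antipode_T₂ (k x : A) :
    TensorProduct.map H.antipode.toLinearMap H.antipode.toLinearMap (H.T₂ (k ⊗ₜ x)) =
      TensorProduct.comm ℂ A A (H.T₁ (H.antipode x ⊗ₜ H.antipode k)) := by
  refine H.nondegenerate.eq_of_lTensor_mulRight fun p' => ?_
  obtain ⟨p, rfl⟩ := H.antipode.surjective p'
  rw [← map_antipode_lTensor_mulLeft, H.lTensor_mulLeft_T₂, map_antipode_rTensor_mulLeft,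
    map_antipode_T₄, LinearMap.rTensor_comm, H.lTensor_mulRight_T₃, ← LinearMap.lTensor_comm]

end Antipode

section RightIntegral

/-- The right integral `φ ∘ S`. -/
def ψ : A →ₗ[ℂ] ℂ := H.φ ∘ₗ H.antipode.toLinearMap

theorem ψ_apply (x : A) : H.ψ x = H.φ (H.antipode x) := rfl

theorem right_invariant (p q : A) : lslice H.ψ (H.T₄ (p ⊗ₜ q)) = H.ψ q • p := by
  apply H.antipode.injective
  have antipode_lslice (t : A ⊗[ℂ] A) : H.antipode (lslice H.ψ t) = lslice H.φ
      (TensorProduct.map H.antipode.toLinearMap H.antipode.toLinearMap t) :=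
    (lslice_map _ H.antipode.toLinearMap _ t).symm
  rw [antipode_lslice, map_antipode_T₄, lslice_comm, H.left_invariant, map_smul, ψ_apply]

theorem ψ_mul_act (k x z : A) : H.ψ (k * H.act (H.toDual z) x) =
    H.φ (x * lslice H.φ (H.T₃ (z ⊗ₜ H.antipode k))) := by
  rw [ψ_apply, antipode_mul, ← sliceT₁_tmul, antipode_sliceT₁, sliceT₄_mul, apply_slice]
  rfl

theorem antipode_mul_sliceT₁ (k x z : A) :
    H.antipode z * H.sliceT₁ (H.antipode x ⊗ₜ H.antipode k) =
      H.antipode.symm (slice (H.φ ∘ₗ LinearMap.mulLeft ℂ (H.antipode x))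
        (H.T₃ (H.antipode k ⊗ₜ H.antipode (H.antipode z)))) := by
  rw [← sliceT₄_mul, antipode_symm_mul, LinearEquiv.symm_apply_apply, ← antipode_sliceT₁,
    LinearEquiv.symm_apply_apply]

theorem ψ_slice_eval_toDual (z : A) (t : A ⊗[ℂ] A) : H.ψ (slice (H.eval (H.toDual z)) t) =
    H.φ (H.antipode.symm (H.antipode z * lslice H.φ
      (TensorProduct.map H.antipode.toLinearMap H.antipode.toLinearMap t))) := by
  rw [apply_slice, lslice_map, antipode_symm_mul, LinearEquiv.symm_apply_apply]
  exact congrArg (fun y => H.φ (y * z)) (H.antipode.symm_apply_apply _).symm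

theorem φ_mul_lslice_T₃ (k x z : A) : H.φ (x * lslice H.φ (H.T₃ (z ⊗ₜ H.antipode k))) =
    H.ψ (H.antipode.symm (lslice (H.φ ∘ₗ H.antipode.symm.toLinearMap ∘ₗ
      H.antipode.symm.toLinearMap)
        (H.T₃ (H.antipode k ⊗ₜ H.antipode (H.antipode z)))) * x) := by
  rw [← ψ_mul_act, mul_act, ψ_slice_eval_toDual, map_antipode_T₂, lslice_comm]
  change H.φ (H.antipode.symm (_ * H.sliceT₁ _)) = _
  rw [antipode_mul_sliceT₁, ψ_apply, antipode_mul, LinearEquiv.apply_symm_apply]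
  exact apply_slice (H.φ ∘ₗ H.antipode.symm.toLinearMap ∘ₗ H.antipode.symm.toLinearMap) _ _

theorem exists_surjective_φ_mul_eq_ψ_mul : ∃ D K : A ⊗[ℂ] A →ₗ[ℂ] A,
    Function.Surjective D ∧ Function.Surjective K ∧ ∀ t x, H.φ (x * D t) = H.ψ (K t * x) := by
  let S := H.antipode
  have φ_comp_ne_zero : H.φ ∘ₗ S.symm.toLinearMap ∘ₗ S.symm.toLinearMap ≠ 0 := fun h =>
    H.φ_ne_zero <| LinearMap.ext fun x => by simpa using LinearMap.congr_fun h (S (S x))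
  obtain ⟨D, D_surjective, D_tmul⟩ : ∃ D : A ⊗[ℂ] A →ₗ[ℂ] A, Function.Surjective D ∧
      ∀ z k, D (z ⊗ₜ k) = lslice H.φ (H.T₃ (z ⊗ₜ S k)) :=
    ⟨lslice H.φ ∘ₗ (S.lTensor A ≪≫ₗ H.T₃).toLinearMap,
      (lslice_surjective H.φ_ne_zero).comp (LinearEquiv.surjective _), fun _ _ => rfl⟩
  obtain ⟨K, K_surjective, K_tmul⟩ : ∃ K : A ⊗[ℂ] A →ₗ[ℂ] A, Function.Surjective K ∧
      ∀ z k, K (z ⊗ₜ k) = S.symm (lslice (H.φ ∘ₗ S.symm.toLinearMap ∘ₗ S.symm.toLinearMap)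
        (H.T₃ (S k ⊗ₜ S (S z)))) :=
    ⟨S.symm.toLinearMap ∘ₗ lslice (H.φ ∘ₗ S.symm.toLinearMap ∘ₗ S.symm.toLinearMap) ∘ₗ
        (TensorProduct.comm ℂ A A ≪≫ₗ TensorProduct.congr S (S ≪≫ₗ S) ≪≫ₗ H.T₃).toLinearMap,
      S.symm.surjective.comp <|
        (lslice_surjective φ_comp_ne_zero).comp (LinearEquiv.surjective _), fun _ _ => rfl⟩
  refine ⟨D, K, D_surjective, K_surjective, fun t x => ?_⟩
  induction t with
  | zero => simp
  | add s t hs ht => simp only [map_add, mul_add, add_mul, hs, ht]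
  | tmul z k => rw [D_tmul, K_tmul, H.φ_mul_lslice_T₃]

/-- The element `ψ(k ·)` of `B`. -/
def toDualRight : A →ₗ[ℂ] H.Dual where
  toFun k := H.ofRange (H.ψ ∘ₗ LinearMap.mulLeft ℂ k) (by
    obtain ⟨D, K, -, hK, h⟩ := H.exists_surjective_φ_mul_eq_ψ_mul
    obtain ⟨t, rfl⟩ := hK k
    exact ⟨D t, LinearMap.ext fun x => h t x⟩)
  map_add' k l := H.dual_ext fun x => by simp [add_mul]
  map_smul' r k := H.dual_ext fun x => by simp [smul_mul_assoc]

@[simp] theorem eval_toDualRight (k x : A) : H.eval (H.toDualRight k) x = H.ψ (k * x) := rfl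

theorem toDualRight_surjective : Function.Surjective H.toDualRight := by
  intro b
  obtain ⟨D, K, hD, -, h⟩ := H.exists_surjective_φ_mul_eq_ψ_mul
  obtain ⟨d, rfl⟩ := H.toDual_surjective b
  obtain ⟨t, rfl⟩ := hD d
  exact ⟨K t, H.dual_ext fun x => (h t x).symm⟩

theorem lslice_ψ_T₄ (s : A ⊗[ℂ] A) : lslice H.ψ (H.T₄ s) = slice H.ψ s := by
  induction s with
  | zero => simp
  | add s t hs ht => simp only [map_add, hs, ht]
  | tmul p q => rw [H.right_invariant, slice_tmul]

theorem lslice_ψ_right_Δ (x : A) (t : A ⊗[ℂ] A) : lslice H.ψ (right (H.Δ x) t) =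
    slice (H.ψ ∘ₗ LinearMap.mulRight ℂ x) (H.T₄.symm t) := by
  obtain ⟨s, rfl⟩ := H.T₄.surjective t
  rw [H.right_Δ_T₄, lslice_ψ_T₄, slice_lTensor, LinearEquiv.symm_apply_apply]

theorem exists_ψ_mul_eq_φ_mul (k : A) : ∃ d, ∀ x, H.ψ (k * x) = H.φ (d * x) := by
  obtain ⟨t, rfl⟩ := lslice_surjective (Y := A) H.φ_ne_zero k
  refine ⟨lslice H.ψ (H.T₂.symm (H.T₄ t)), fun x => ?_⟩
  have φ_ψ_eq_ψ_φ := apply_slice H.ψ H.φ (right (H.Δ x) (H.T₄ t))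
  rw [slice_φ_right_Δ, lslice_ψ_right_Δ, apply_slice, apply_slice,
    LinearEquiv.symm_apply_apply] at φ_ψ_eq_ψ_φ
  exact φ_ψ_eq_ψ_φ.symm

theorem toDual_injective : Function.Injective H.toDual := by
  rw [injective_iff_map_eq_zero]
  intro c hc
  refine H.eq_zero_of_eval fun b => ?_
  obtain ⟨k, rfl⟩ := H.toDualRight_surjective b
  obtain ⟨d, hd⟩ := H.exists_ψ_mul_eq_φ_mul k
  rw [eval_toDualRight, hd, ← eval_toDual, hc]
  simp

theorem toDualRight_injective : Function.Injective H.toDualRight := by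
  rw [injective_iff_map_eq_zero]
  intro k hk
  refine (H.antipode.map_eq_zero_iff).1 <| H.toDual_injective <| H.dual_ext fun x => ?_
  simpa [ψ_apply, antipode_mul] using congrArg (fun b => H.eval b (H.antipode.symm x)) hk

/-- The isomorphism `c ↦ φ(· c)` of `A` onto `B`. -/
def dualEquiv : A ≃ₗ[ℂ] H.Dual :=
  LinearEquiv.ofBijective H.toDual ⟨H.toDual_injective, H.toDual_surjective⟩

/-- The isomorphism `c ↦ ψ(c ·)` of `A` onto `B`. -/
def dualEquivRight : A ≃ₗ[ℂ] H.Dual :=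
  LinearEquiv.ofBijective H.toDualRight ⟨H.toDualRight_injective, H.toDualRight_surjective⟩

@[simp] theorem dualEquiv_symm_toDual (c : A) : H.dualEquiv.symm (H.toDual c) = c :=
  H.dualEquiv.symm_apply_apply c

@[simp] theorem dualEquivRight_symm_toDualRight (c : A) :
    H.dualEquivRight.symm (H.toDualRight c) = c :=
  H.dualEquivRight.symm_apply_apply c

end RightIntegral

section RightAction

/-- The right action of `B` on `A`: `a ◁ b = (⟨·, b⟩ ⊗ ι)Δ(a)`. For `b = φ(· c)` it is
`(φ ⊗ ι)(Δ(a)(c ⊗ 1))`. -/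
def actR : H.Dual →ₗ[ℂ] A →ₗ[ℂ] A :=
  (TensorProduct.curry (lslice H.φ ∘ₗ H.T₃.toLinearMap)).flip ∘ₗ H.dualEquiv.symm.toLinearMap

theorem actR_toDual (c a : A) : H.actR (H.toDual c) a = lslice H.φ (H.T₃ (a ⊗ₜ c)) := by
  simp [actR]

theorem actR_mul (b : H.Dual) (a e : A) :
    H.actR b a * e = lslice (H.eval b) (H.T₁ (a ⊗ₜ e)) := by
  obtain ⟨c, rfl⟩ := H.toDual_surjective b
  have h := congrArg (lslice H.φ) (H.lTensor_mulRight_T₃ a c e)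
  rw [lslice_lTensor, lslice_rTensor] at h
  rw [actR_toDual]
  exact h

theorem mul_actR (b : H.Dual) (a e : A) :
    e * H.actR b a = lslice (H.eval b) (H.T₄ (e ⊗ₜ a)) := by
  refine H.nondegenerate.eq_of_mul_right fun z => ?_
  have h := congrArg (lslice (H.eval b)) (H.lTensor_mulRight_T₄ e a z)
  rw [lslice_lTensor, lslice_lTensor, ← actR_mul] at h
  rw [mul_assoc]
  exact h.symm

theorem mul_actR_toDualRight (c a x : A) : a * H.actR (H.toDualRight c) x =
    slice (H.ψ ∘ₗ LinearMap.mulRight ℂ x) (H.T₄.symm (c ⊗ₜ a)) := by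
  rw [mul_actR, ← lslice_ψ_right_Δ, H.right_Δ_tmul_eq_T₄, lslice_rTensor]
  rfl

theorem eval_mul_eq_eval_actR (b b' : H.Dual) (a : A) :
    H.eval (b * b') a = H.eval b' (H.actR b a) := by
  obtain ⟨c, rfl⟩ := H.toDual_surjective b'
  rw [eval_mul, act_toDual, apply_slice, ← actR_mul, eval_toDual]

theorem actR_act (b b' : H.Dual) (a : A) : H.actR b (H.act b' a) = H.act b' (H.actR b a) := by
  refine H.eq_of_eval fun f => ?_
  rw [← eval_mul_eq_eval_actR, ← eval_mul, ← eval_mul, ← eval_mul_eq_eval_actR, mul_assoc]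

end RightAction

section Duality

variable {Y : Type*} [AddCommGroup Y] [Module ℂ Y]

/-- The slice map `⟨a, ·⟩ ⊗ ι` on `B ⊗ Y`, as a linear function of `a`. -/
def sliceAt : A →ₗ[ℂ] H.Dual ⊗[ℂ] Y →ₗ[ℂ] Y :=
  (TensorProduct.lid ℂ Y).congrRight.toLinearMap ∘ₗ LinearMap.rTensorHom Y ∘ₗ H.eval.flip

theorem sliceAt_eq_lslice (a : A) : H.sliceAt (Y := Y) a = lslice (H.eval.flip a) := rfl

@[simp] theorem sliceAt_tmul (a : A) (b : H.Dual) (y : Y) :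
    H.sliceAt a (b ⊗ₜ y) = H.eval b a • y := by
  simp [sliceAt_eq_lslice]

theorem eq_of_sliceAt {s t : H.Dual ⊗[ℂ] Y} (h : ∀ a, H.sliceAt a s = H.sliceAt a t) : s = t :=
  eq_of_rTensor (fun a => H.eval.flip a) (fun _ hb => H.dual_ext fun a => by simpa using hb a)
    fun a => (TensorProduct.lid ℂ Y).injective (h a)

theorem eq_of_slice_eval {s t : Y ⊗[ℂ] A} (h : ∀ b, slice (H.eval b) s = slice (H.eval b) t) :
    s = t :=
  eq_of_lTensor (fun b => H.eval b) (fun _ ha => H.eq_of_eval fun b => by simpa using ha b)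
    fun b => (TensorProduct.rid ℂ Y).injective (h b)

theorem sliceAt_mul_tmul (t : H.Dual ⊗[ℂ] A) (b : H.Dual) (a x : A) :
    H.sliceAt x (t * b ⊗ₜ a) = H.sliceAt (H.act b x) t * a := by
  induction t with
  | zero => simp
  | add s t hs ht => simp only [map_add, add_mul, hs, ht]
  | tmul b' a' => simp [smul_mul_assoc]

theorem sliceAt_tmul_mul (t : H.Dual ⊗[ℂ] A) (b : H.Dual) (a x : A) :
    H.sliceAt x (b ⊗ₜ a * t) = a * H.sliceAt (H.actR b x) t := by
  induction t with
  | zero => simp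
  | add s t hs ht => simp only [map_add, mul_add, hs, ht]
  | tmul b' a' => simp [-eval_mul, eval_mul_eq_eval_actR, mul_smul_comm]

/-- Left multiplication by `V`: slicing `V(b ⊗ a)` at `x` gives `(b ▷ x)a`. -/
def dualityLeft : H.Dual ⊗[ℂ] A →ₗ[ℂ] H.Dual ⊗[ℂ] A :=
  LinearMap.rTensor A H.toDual ∘ₗ H.T₃.symm.toLinearMap ∘ₗ
    (TensorProduct.comm ℂ A A).toLinearMap ∘ₗ LinearMap.rTensor A H.dualEquiv.symm.toLinearMap

theorem dualityLeft_toDual (c a : A) : H.dualityLeft (H.toDual c ⊗ₜ a) =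
    LinearMap.rTensor A H.toDual (H.T₃.symm (a ⊗ₜ c)) := by
  simp [dualityLeft]

theorem sliceAt_dualityLeft (b : H.Dual) (a x : A) :
    H.sliceAt x (H.dualityLeft (b ⊗ₜ a)) = H.act b x * a := by
  obtain ⟨c, rfl⟩ := H.toDual_surjective b
  rw [dualityLeft_toDual, sliceAt_eq_lslice, lslice_rTensor,
    H.act_mul _ x a c (LinearEquiv.apply_symm_apply _ _)]
  rfl

/-- Right multiplication by `V`: slicing `(b ⊗ a)V` at `x` gives `a(x ◁ b)`. -/
def dualityRight : H.Dual ⊗[ℂ] A →ₗ[ℂ] H.Dual ⊗[ℂ] A :=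
  LinearMap.rTensor A H.toDualRight ∘ₗ (TensorProduct.comm ℂ A A).toLinearMap ∘ₗ
    H.T₄.symm.toLinearMap ∘ₗ LinearMap.rTensor A H.dualEquivRight.symm.toLinearMap

theorem dualityRight_toDualRight (c a : A) : H.dualityRight (H.toDualRight c ⊗ₜ a) =
    LinearMap.rTensor A H.toDualRight (TensorProduct.comm ℂ A A (H.T₄.symm (c ⊗ₜ a))) := by
  simp [dualityRight]

theorem sliceAt_dualityRight (b : H.Dual) (a x : A) :
    H.sliceAt x (H.dualityRight (b ⊗ₜ a)) = a * H.actR b x := by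
  obtain ⟨c, rfl⟩ := H.toDualRight_surjective b
  rw [dualityRight_toDualRight, sliceAt_eq_lslice, lslice_rTensor, lslice_comm,
    mul_actR_toDualRight]
  rfl

theorem dualityRight_mul (s t : H.Dual ⊗[ℂ] A) : H.dualityRight s * t = s * H.dualityLeft t := by
  induction s with
  | zero => simp
  | add s s' hs hs' => simp only [map_add, add_mul, hs, hs']
  | tmul b a =>
    induction t with
    | zero => simp
    | add t t' ht ht' => simp only [map_add, mul_add, ht, ht']
    | tmul b' a' =>
      refine H.eq_of_sliceAt fun x => ?_
      rw [sliceAt_mul_tmul, sliceAt_tmul_mul, sliceAt_dualityLeft, sliceAt_dualityRight, actR_act,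
        mul_assoc]

/-- The duality `V ∈ M(B ⊗ A)`. -/
def duality : Multiplier (H.Dual ⊗[ℂ] A) :=
  Multiplier.mk H.dualityLeft H.dualityRight H.dualityRight_mul

theorem pairMixed_tmul (t : H.Dual ⊗[ℂ] A) (a : A) (b : H.Dual) :
    H.pairMixed t (a ⊗ₜ b) = H.eval b (H.sliceAt a t) := by
  induction t <;> simp_all [pairMixed]

theorem isDuality_iff (V : Multiplier (H.Dual ⊗[ℂ] A)) : H.IsDuality V ↔ V = H.duality := by
  constructor
  · intro hV
    refine ext_left (H.dual_nondegenerate.tensor H.nondegenerate) fun t => ?_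
    induction t with
    | zero => simp
    | add s t hs ht => simp only [map_add, hs, ht]
    | tmul b a =>
      refine H.eq_of_sliceAt fun x => H.eq_of_eval fun b' => ?_
      rw [← pairMixed_tmul, hV, duality, left_mk, sliceAt_dualityLeft]
      rfl
  · rintro rfl b a x b'
    rw [pairMixed_tmul, duality, left_mk, sliceAt_dualityLeft]
    rfl

end Duality

section Coproduct

theorem pairDual_tmul (t : H.Dual ⊗[ℂ] H.Dual) (x y : A) :
    H.pairDual t (x ⊗ₜ y) = H.eval (H.sliceAt x t) y := by
  induction t <;> simp_all [pairDual]

@[simp] theorem pairDual_tmul_tmul (b b' : H.Dual) (x y : A) :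
    H.pairDual (b ⊗ₜ b') (x ⊗ₜ y) = H.eval b x * H.eval b' y := rfl

theorem eq_of_pairDual {s t : H.Dual ⊗[ℂ] H.Dual}
    (h : ∀ x y, H.pairDual s (x ⊗ₜ y) = H.pairDual t (x ⊗ₜ y)) : s = t :=
  H.eq_of_sliceAt fun x => H.dual_ext fun y => by rw [← pairDual_tmul, h, pairDual_tmul]

theorem multiplier_ext_pairDual {m n : Multiplier (H.Dual ⊗[ℂ] H.Dual)}
    (h : ∀ b₁ b₂ x y, H.pairDual (left m (b₁ ⊗ₜ b₂)) (x ⊗ₜ y) =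
      H.pairDual (left n (b₁ ⊗ₜ b₂)) (x ⊗ₜ y)) : m = n :=
  ext_left (H.dual_nondegenerate.tensor H.dual_nondegenerate) <| LinearMap.congr_fun <|
    TensorProduct.ext' fun b₁ b₂ => H.eq_of_pairDual (h b₁ b₂)

theorem pairDual_rTensor_mulRight (t : H.Dual ⊗[ℂ] H.Dual) (b : H.Dual) (x y : A) :
    H.pairDual (LinearMap.rTensor H.Dual (LinearMap.mulRight ℂ b) t) (x ⊗ₜ y) =
      H.pairDual t (H.act b x ⊗ₜ y) := by
  induction t <;> simp_all

theorem pairDual_lTensor_mulLeft (t : H.Dual ⊗[ℂ] H.Dual) (b : H.Dual) (x y : A) :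
    H.pairDual (LinearMap.lTensor H.Dual (LinearMap.mulLeft ℂ b) t) (x ⊗ₜ y) =
      H.pairDual t (x ⊗ₜ H.actR b y) := by
  induction t <;> simp_all [-eval_mul, eval_mul_eq_eval_actR]

theorem pairDual_mul_tmul (t : H.Dual ⊗[ℂ] H.Dual) (b b' : H.Dual) (x y : A) :
    H.pairDual (t * b ⊗ₜ b') (x ⊗ₜ y) = H.pairDual t (H.act b x ⊗ₜ H.act b' y) := by
  induction t <;> simp_all [add_mul]

theorem pairDual_tmul_mul (t : H.Dual ⊗[ℂ] H.Dual) (b b' : H.Dual) (x y : A) :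
    H.pairDual (b ⊗ₜ b' * t) (x ⊗ₜ y) = H.pairDual t (H.actR b x ⊗ₜ H.actR b' y) := by
  induction t <;> simp_all [mul_add, -eval_mul, eval_mul_eq_eval_actR]

/-- The bijection `b ⊗ b' ↦ Δ(b)(1 ⊗ b')`. -/
def dualT₁ : H.Dual ⊗[ℂ] H.Dual ≃ₗ[ℂ] H.Dual ⊗[ℂ] H.Dual :=
  (TensorProduct.congr H.dualEquiv H.dualEquiv).symm ≪≫ₗ H.T₃.symm ≪≫ₗ
    TensorProduct.comm ℂ A A ≪≫ₗ TensorProduct.congr H.dualEquiv H.dualEquiv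

theorem dualT₁_toDual (c c' : A) : H.dualT₁ (H.toDual c ⊗ₜ H.toDual c') =
    TensorProduct.map H.toDual H.toDual (TensorProduct.comm ℂ A A (H.T₃.symm (c ⊗ₜ c'))) := by
  simp only [dualT₁, LinearEquiv.trans_apply, TensorProduct.congr_symm_tmul, dualEquiv_symm_toDual]
  rfl

theorem pairDual_dualT₁ (b b' : H.Dual) (x y : A) :
    H.pairDual (H.dualT₁ (b ⊗ₜ b')) (x ⊗ₜ y) = H.eval b (x * H.act b' y) := by
  obtain ⟨c, rfl⟩ := H.toDual_surjective b
  obtain ⟨c', rfl⟩ := H.toDual_surjective b'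
  rw [dualT₁_toDual, eval_toDual, mul_assoc,
    H.act_mul _ y c c' (LinearEquiv.apply_symm_apply _ _)]
  induction H.T₃.symm (c ⊗ₜ c') with
  | zero => simp
  | add s t hs ht => simp only [map_add, mul_add, LinearMap.add_apply, hs, ht]
  | tmul p q => simp [mul_comm, mul_smul_comm]

theorem sliceAt_dualT₁ (b b' : H.Dual) (x : A) :
    H.sliceAt x (H.dualT₁ (b ⊗ₜ b')) = H.actMul b b' x :=
  H.dual_ext fun y => by rw [← pairDual_tmul, pairDual_dualT₁, eval_actMul]

/-- The bijection `b ⊗ b' ↦ (b ⊗ 1)Δ(b')`. -/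
def dualT₂ : H.Dual ⊗[ℂ] H.Dual ≃ₗ[ℂ] H.Dual ⊗[ℂ] H.Dual :=
  (TensorProduct.congr H.dualEquivRight H.dualEquivRight).symm ≪≫ₗ H.T₄.symm ≪≫ₗ
    TensorProduct.comm ℂ A A ≪≫ₗ TensorProduct.congr H.dualEquivRight H.dualEquivRight

theorem dualT₂_toDualRight (c c' : A) : H.dualT₂ (H.toDualRight c ⊗ₜ H.toDualRight c') =
    TensorProduct.map H.toDualRight H.toDualRight
      (TensorProduct.comm ℂ A A (H.T₄.symm (c ⊗ₜ c'))) := by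
  simp only [dualT₂, LinearEquiv.trans_apply, TensorProduct.congr_symm_tmul,
    dualEquivRight_symm_toDualRight]
  rfl

theorem pairDual_dualT₂ (b b' : H.Dual) (x y : A) :
    H.pairDual (H.dualT₂ (b ⊗ₜ b')) (x ⊗ₜ y) = H.eval b' (H.actR b x * y) := by
  obtain ⟨c, rfl⟩ := H.toDualRight_surjective b
  obtain ⟨c', rfl⟩ := H.toDualRight_surjective b'
  rw [dualT₂_toDualRight, eval_toDualRight, ← mul_assoc, mul_actR_toDualRight]
  induction H.T₄.symm (c ⊗ₜ c') with
  | zero => simp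
  | add s t hs ht => simp only [map_add, add_mul, LinearMap.add_apply, hs, ht]
  | tmul p q => simp [smul_mul_assoc]

/-- Left multiplication by `Δ(b)`. -/
def coproductLeft (b : H.Dual) : H.Dual ⊗[ℂ] H.Dual →ₗ[ℂ] H.Dual ⊗[ℂ] H.Dual :=
  TensorProduct.lift ((LinearMap.rTensorHom H.Dual ∘ₗ (LinearMap.mul ℂ H.Dual).flip).compl₂
    (H.dualT₁.toLinearMap ∘ₗ TensorProduct.mk ℂ H.Dual H.Dual b))

theorem coproductLeft_tmul (b b₁ b₂ : H.Dual) : H.coproductLeft b (b₁ ⊗ₜ b₂) =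
    LinearMap.rTensor H.Dual (LinearMap.mulRight ℂ b₁) (H.dualT₁ (b ⊗ₜ b₂)) := rfl

theorem pairDual_coproductLeft_tmul (b b₁ b₂ : H.Dual) (x y : A) :
    H.pairDual (H.coproductLeft b (b₁ ⊗ₜ b₂)) (x ⊗ₜ y) =
      H.eval b (H.act b₁ x * H.act b₂ y) := by
  rw [coproductLeft_tmul, pairDual_rTensor_mulRight, pairDual_dualT₁]

/-- Right multiplication by `Δ(b)`. -/
def coproductRight (b : H.Dual) : H.Dual ⊗[ℂ] H.Dual →ₗ[ℂ] H.Dual ⊗[ℂ] H.Dual :=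
  TensorProduct.lift ((LinearMap.lTensorHom H.Dual ∘ₗ LinearMap.mul ℂ H.Dual).compl₂
    (H.dualT₂.toLinearMap ∘ₗ (TensorProduct.mk ℂ H.Dual H.Dual).flip b)).flip

theorem coproductRight_tmul (b b₁ b₂ : H.Dual) : H.coproductRight b (b₁ ⊗ₜ b₂) =
    LinearMap.lTensor H.Dual (LinearMap.mulLeft ℂ b₂) (H.dualT₂ (b₁ ⊗ₜ b)) := rfl

theorem pairDual_coproductRight_tmul (b b₁ b₂ : H.Dual) (x y : A) :
    H.pairDual (H.coproductRight b (b₁ ⊗ₜ b₂)) (x ⊗ₜ y) =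
      H.eval b (H.actR b₁ x * H.actR b₂ y) := by
  rw [coproductRight_tmul, pairDual_lTensor_mulLeft, pairDual_dualT₂]

theorem coproductRight_mul (b : H.Dual) (s t : H.Dual ⊗[ℂ] H.Dual) :
    H.coproductRight b s * t = s * H.coproductLeft b t := by
  induction s with
  | zero => simp
  | add s s' hs hs' => simp only [map_add, add_mul, hs, hs']
  | tmul b₁ b₂ =>
    induction t with
    | zero => simp
    | add t t' ht ht' => simp only [map_add, mul_add, ht, ht']
    | tmul b₃ b₄ =>
      refine H.eq_of_pairDual fun x y => ?_
      rw [pairDual_mul_tmul, pairDual_tmul_mul, pairDual_coproductLeft_tmul,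
        pairDual_coproductRight_tmul, actR_act, actR_act]

/-- The element `∑ (b ▷ x) ⊗ b'` of the Heisenberg algebra for `∑ b ⊗ b'` in `B ⊗ B`. -/
def heisSlice (x : A) : H.Dual ⊗[ℂ] H.Dual →ₗ[ℂ] H.Heisenberg :=
  LinearMap.rTensor H.Dual (H.act.flip x)

@[simp] theorem heisSlice_tmul (x : A) (b b' : H.Dual) :
    H.heisSlice x (b ⊗ₜ b') = H.heis (H.act b x) b' := rfl

theorem heisSlice_rTensor_mulRight (x : A) (b : H.Dual) (t : H.Dual ⊗[ℂ] H.Dual) :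
    H.heisSlice x (LinearMap.rTensor H.Dual (LinearMap.mulRight ℂ b) t) =
      H.heisSlice (H.act b x) t := by
  induction t <;> simp_all [act_mul_apply]

/-- The map `ι ⊗ f` from `A ⊗ A` to the Heisenberg algebra `A ⊗ B`, as a linear function of `f`. -/
def heisMap : (A →ₗ[ℂ] H.Dual) →ₗ[ℂ] A ⊗[ℂ] A →ₗ[ℂ] H.Heisenberg :=
  LinearMap.lTensorHom A

@[simp] theorem heisMap_tmul (f : A →ₗ[ℂ] H.Dual) (p q : A) :
    H.heisMap f (p ⊗ₜ q) = H.heis p (f q) := rfl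

theorem heisAct_heisMap_sliceAt (b b' : H.Dual) (w : A ⊗[ℂ] A) (y : A) :
    H.heisAct (H.heisMap (H.sliceAt.flip (b ⊗ₜ b')) w) y =
      slice (H.eval b) w * H.act b' y := by
  induction w <;> simp_all [add_mul, smul_mul_assoc]

theorem mul_heisAct_heisSlice (t : H.Dual ⊗[ℂ] H.Dual) (a x y : A) :
    a * H.heisAct (H.heisSlice x t) y =
      H.heisAct (H.heisMap (H.sliceAt.flip t) (H.T₂ (a ⊗ₜ x))) y := by
  induction t with
  | zero => simp
  | add s t hs ht => simp only [map_add, LinearMap.add_apply, mul_add, hs, ht]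
  | tmul b b' =>
    rw [heisAct_heisMap_sliceAt, heisSlice_tmul, heisAct_heis, ← mul_assoc, H.mul_act b]

theorem heisAct_heisSlice_dualT₁ (b b' : H.Dual) (x y : A) :
    H.heisAct (H.heisSlice x (H.dualT₁ (b ⊗ₜ b'))) y = H.act b (x * H.act b' y) := by
  refine H.nondegenerate.eq_of_mul_left fun a => ?_
  have slice_dualT₁ : H.sliceAt.flip (H.dualT₁ (b ⊗ₜ b')) = H.actMulₗ (b ⊗ₜ b') :=
    LinearMap.ext fun q => H.sliceAt_dualT₁ b b' q
  have heisMap_T₂ : H.heisMap (H.actMulₗ (b ⊗ₜ b')) (H.T₂ (a ⊗ₜ x)) = H.heis a b * H.heis x b' :=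
    (H.heis_mul_heis a x b b').symm
  rw [mul_heisAct_heisSlice, slice_dualT₁, heisMap_T₂, heisAct_mul, heisAct_heis, heisAct_heis]

theorem heisAct_heisSlice_coproductLeft (b : H.Dual) (t : H.Dual ⊗[ℂ] H.Dual) (x y : A) :
    H.heisAct (H.heisSlice x (H.coproductLeft b t)) y =
      H.act b (H.heisAct (H.heisSlice x t) y) := by
  induction t with
  | zero => simp
  | add s t hs ht => simp only [map_add, LinearMap.add_apply, hs, ht]
  | tmul b₁ b₂ =>
    rw [coproductLeft_tmul, heisSlice_rTensor_mulRight, heisAct_heisSlice_dualT₁, heisSlice_tmul,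
      heisAct_heis]

theorem pairDual_coproductLeft (b : H.Dual) (t : H.Dual ⊗[ℂ] H.Dual) (x y : A) :
    H.pairDual (H.coproductLeft b t) (x ⊗ₜ y) = H.eval b (H.heisAct (H.heisSlice x t) y) := by
  induction t with
  | zero => simp
  | add s t hs ht => simp only [map_add, LinearMap.add_apply, hs, ht]
  | tmul b₁ b₂ => rw [pairDual_coproductLeft_tmul, heisSlice_tmul, heisAct_heis]

/-- The coproduct of `B`. -/
def coproduct : H.Dual →ₙₐ[ℂ] Multiplier (H.Dual ⊗[ℂ] H.Dual) where
  toFun b := Multiplier.mk (H.coproductLeft b) (H.coproductRight b) (H.coproductRight_mul b)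
  map_smul' r b := H.multiplier_ext_pairDual fun b₁ b₂ x y => by
    simp [pairDual_coproductLeft]
  map_zero' := H.multiplier_ext_pairDual fun b₁ b₂ x y => by
    simp [pairDual_coproductLeft]
  map_add' b b' := H.multiplier_ext_pairDual fun b₁ b₂ x y => by
    simp [pairDual_coproductLeft]
  map_mul' b b' := H.multiplier_ext_pairDual fun b₁ b₂ x y => by
    rw [left_mul, left_mk, left_mk, left_mk, pairDual_coproductLeft, pairDual_coproductLeft,
      eval_mul, heisAct_heisSlice_coproductLeft]

theorem left_coproduct (b : H.Dual) : left (H.coproduct b) = H.coproductLeft b := rfl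

theorem isDualCoproduct_iff (ΔB : H.Dual →ₙₐ[ℂ] Multiplier (H.Dual ⊗[ℂ] H.Dual)) :
    H.IsDualCoproduct ΔB ↔ ΔB = H.coproduct := by
  constructor
  · intro h
    ext b
    refine H.multiplier_ext_pairDual fun b₁ b₂ x y => ?_
    rw [h, left_coproduct, pairDual_coproductLeft_tmul]
  · rintro rfl b b₁ b₂ x y
    rw [left_coproduct, pairDual_coproductLeft_tmul]

end Coproduct

section Embeddings

theorem multiplier_ext_heisAct {m n : Multiplier H.Heisenberg}
    (h : ∀ s x, H.heisAct (left m s) x = H.heisAct (left n s) x) : m = n :=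
  ext_left H.heisenberg_nondegenerate fun s => H.heis_ext (h s)

theorem eq_top_of_heis_mem {S : Submodule ℂ H.Heisenberg} (h : ∀ a b, H.heis a b ∈ S) : S = ⊤ :=
  Submodule.eq_top_iff'.2 (H.heis_induction h fun _ _ => S.add_mem)

/-- An algebra `P` acting on `A` through `ρ` maps to the multipliers of the Heisenberg algebra as
soon as composition with `ρ p` on either side preserves the operators from the Heisenberg
algebra: `L p` and `R p` are the multiplications by `p` from the left and from the right. -/
def homOfAction {P : Type*} [NonUnitalRing P] [Module ℂ P]
    (ρ : P →ₗ[ℂ] A →ₗ[ℂ] A) (hρ : ∀ p q x, ρ (p * q) x = ρ p (ρ q x))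
    (L R : P → H.Heisenberg →ₗ[ℂ] H.Heisenberg)
    (hL : ∀ p s x, H.heisAct (L p s) x = ρ p (H.heisAct s x))
    (hR : ∀ p s x, H.heisAct (R p s) x = H.heisAct s (ρ p x)) :
    P →ₙₐ[ℂ] Multiplier H.Heisenberg where
  toFun p := Multiplier.mk (L p) (R p) fun s t => H.heis_ext fun x => by
    rw [heisAct_mul, heisAct_mul, hL, hR]
  map_smul' r p := H.multiplier_ext_heisAct fun s x => by simp [hL]
  map_zero' := H.multiplier_ext_heisAct fun s x => by simp [hL]
  map_add' p q := H.multiplier_ext_heisAct fun s x => by simp [hL]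
  map_mul' p q := H.multiplier_ext_heisAct fun s x => by simp [hL, hρ]

/-- Left multiplication by `a ∈ A` on the Heisenberg algebra. -/
def embALeft (a : A) : H.Heisenberg →ₗ[ℂ] H.Heisenberg :=
  LinearMap.rTensor H.Dual (LinearMap.mulLeft ℂ a)

@[simp] theorem embALeft_heis (a a' : A) (b : H.Dual) :
    H.embALeft a (H.heis a' b) = H.heis (a * a') b := rfl

theorem heisAct_embALeft (a : A) (s : H.Heisenberg) (x : A) :
    H.heisAct (H.embALeft a s) x = a * H.heisAct s x := by
  induction s using H.heis_induction with
  | h p b => simp [mul_assoc]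
  | hadd s t hs ht => simp only [map_add, LinearMap.add_apply, mul_add, hs, ht]

/-- The right action of `A` on `B`: `⟨x, b ◁ a⟩ = ⟨a x, b⟩`. -/
def actDualR : H.Dual →ₗ[ℂ] A →ₗ[ℂ] H.Dual :=
  (LinearMap.mul ℂ A).compr₂ H.toDualRight ∘ₗ H.dualEquivRight.symm.toLinearMap

theorem actDualR_toDualRight (c a : A) :
    H.actDualR (H.toDualRight c) a = H.toDualRight (c * a) := by
  simp [actDualR]

theorem eval_comp_mulLeft (b : H.Dual) (a : A) :
    H.eval b ∘ₗ LinearMap.mulLeft ℂ a = H.eval (H.actDualR b a) := by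
  obtain ⟨c, rfl⟩ := H.toDualRight_surjective b
  rw [actDualR_toDualRight]
  ext x
  simp [mul_assoc]

/-- Right multiplication by `a ∈ A` on the Heisenberg algebra:
`(a' ⊗ b)a = ∑ a'a₍₁₎ ⊗ (b ◁ a₍₂₎)`. -/
def embARight (a : A) : H.Heisenberg →ₗ[ℂ] H.Heisenberg :=
  TensorProduct.lift ((H.heisMap ∘ₗ H.actDualR).compl₂
    (H.T₂.toLinearMap ∘ₗ (TensorProduct.mk ℂ A A).flip a)).flip

theorem embARight_heis (a a' : A) (b : H.Dual) :
    H.embARight a (H.heis a' b) = H.heisMap (H.actDualR b) (H.T₂ (a' ⊗ₜ a)) := rfl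

theorem heisAct_heisMap_actDualR (b : H.Dual) (w : A ⊗[ℂ] A) (x : A) :
    H.heisAct (H.heisMap (H.actDualR b) w) x = slice (H.eval b) (right (H.Δ x) w) := by
  induction w with
  | zero => simp
  | add v w hv hw => simp only [map_add, LinearMap.add_apply, hv, hw]
  | tmul p q =>
    rw [heisMap_tmul, heisAct_heis, mul_act, H.right_tmul_eq, ← eval_comp_mulLeft, slice_map,
      LinearMap.id_apply]

theorem heisAct_embARight (a : A) (s : H.Heisenberg) (x : A) :
    H.heisAct (H.embARight a s) x = H.heisAct s (a * x) := by
  induction s using H.heis_induction with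
  | h p b => rw [embARight_heis, heisAct_heisMap_actDualR, H.right_T₂, heisAct_heis, mul_act]
  | hadd s t hs ht => simp only [map_add, LinearMap.add_apply, hs, ht]

/-- The embedding of `A` in the multiplier algebra of the Heisenberg algebra. -/
def embA : A →ₙₐ[ℂ] Multiplier H.Heisenberg :=
  H.homOfAction (LinearMap.mul ℂ A) mul_assoc H.embALeft H.embARight H.heisAct_embALeft
    H.heisAct_embARight

theorem left_embA (a : A) : left (H.embA a) = H.embALeft a := rfl

/-- Left multiplication by `b ∈ B` on the Heisenberg algebra:
`b(a ⊗ b') = ∑ (b₍₁₎ ▷ a) ⊗ b₍₂₎b'`. -/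
def embBLeft (b : H.Dual) : H.Heisenberg →ₗ[ℂ] H.Heisenberg :=
  TensorProduct.lift ((LinearMap.rTensorHom H.Dual ∘ₗ H.act.flip).compl₂
    (H.dualT₁.toLinearMap ∘ₗ TensorProduct.mk ℂ H.Dual H.Dual b))

theorem embBLeft_heis (b : H.Dual) (a : A) (b' : H.Dual) :
    H.embBLeft b (H.heis a b') = H.heisSlice a (H.dualT₁ (b ⊗ₜ b')) := rfl

theorem heisAct_embBLeft (b : H.Dual) (s : H.Heisenberg) (x : A) :
    H.heisAct (H.embBLeft b s) x = H.act b (H.heisAct s x) := by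
  induction s using H.heis_induction with
  | h p b' => rw [embBLeft_heis, heisAct_heisSlice_dualT₁, heisAct_heis]
  | hadd s t hs ht => simp only [map_add, LinearMap.add_apply, hs, ht]

/-- Right multiplication by `b ∈ B` on the Heisenberg algebra. -/
def embBRight (b : H.Dual) : H.Heisenberg →ₗ[ℂ] H.Heisenberg :=
  LinearMap.lTensor A (LinearMap.mulRight ℂ b)

@[simp] theorem embBRight_heis (b : H.Dual) (a : A) (b' : H.Dual) :
    H.embBRight b (H.heis a b') = H.heis a (b' * b) := rfl

theorem heisAct_embBRight (b : H.Dual) (s : H.Heisenberg) (x : A) :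
    H.heisAct (H.embBRight b s) x = H.heisAct s (H.act b x) := by
  induction s using H.heis_induction with
  | h p b' => simp [act_mul_apply]
  | hadd s t hs ht => simp only [map_add, LinearMap.add_apply, hs, ht]

/-- The embedding of `B` in the multiplier algebra of the Heisenberg algebra. -/
def embB : H.Dual →ₙₐ[ℂ] Multiplier H.Heisenberg :=
  H.homOfAction H.act H.act_mul_apply H.embBLeft H.embBRight H.heisAct_embBLeft
    H.heisAct_embBRight

theorem left_embB (b : H.Dual) : left (H.embB b) = H.embBLeft b := rfl

theorem right_embB (b : H.Dual) : right (H.embB b) = H.embBRight b := rfl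

theorem isHeisenbergEmbedding_iff (jA : A →ₙₐ[ℂ] Multiplier H.Heisenberg)
    (jB : H.Dual →ₙₐ[ℂ] Multiplier H.Heisenberg) :
    H.IsHeisenbergEmbedding jA jB ↔ jA = H.embA ∧ jB = H.embB := by
  refine ⟨fun ⟨hA, hB⟩ => ⟨?_, ?_⟩, ?_⟩
  · ext a
    refine ext_left H.heisenberg_nondegenerate fun s => ?_
    induction s using H.heis_induction with
    | h p b => rw [hA, left_embA, embALeft_heis]
    | hadd s t hs ht => rw [map_add, map_add, hs, ht]
  · ext b
    refine ext_right H.heisenberg_nondegenerate fun s => ?_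
    induction s using H.heis_induction with
    | h p b => rw [hB, right_embB, embBRight_heis]
    | hadd s t hs ht => rw [map_add, map_add, hs, ht]
  · rintro ⟨rfl, rfl⟩
    exact ⟨fun a a' b => rfl, fun b a' b' => rfl⟩

theorem embA_mul_embB (a : A) (b : H.Dual) : H.embA a * H.embB b = of (H.heis a b) :=
  H.multiplier_ext_heisAct fun s x => by
    rw [left_mul, left_embA, left_embB, heisAct_embALeft, heisAct_embBLeft, left_of, heisAct_mul,
      heisAct_heis]

theorem embA_nondegenerate : IsNondegenerateHom H.embA := by
  constructor <;> refine H.eq_top_of_heis_mem fun a b => ?_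
  · refine map_mem_of_surjective H.mul'_surjective (H.heis.flip b) (fun x y => ?_) a
    exact Submodule.subset_span ⟨x, H.heis y b, rfl⟩
  · obtain ⟨c, rfl⟩ := H.toDualRight_surjective b
    refine map_mem_of_surjective H.mul'_surjective (H.heis a ∘ₗ H.toDualRight) (fun x y => ?_) c
    suffices H.heisMap (H.actDualR (H.toDualRight x)) (a ⊗ₜ y) ∈
        Submodule.span ℂ {s | ∃ p t, s = right (H.embA p) t} by
      rwa [heisMap_tmul, actDualR_toDualRight] at this
    refine map_mem_of_surjective (e := H.T₂.toLinearMap) H.T₂.surjective _ (fun p q => ?_) _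
    exact Submodule.subset_span ⟨q, H.heis p (H.toDualRight x), rfl⟩

theorem embB_nondegenerate : IsNondegenerateHom H.embB := by
  constructor <;> refine H.eq_top_of_heis_mem fun a b => ?_
  · have heisSlice_mem (x : A) (t : H.Dual ⊗[ℂ] H.Dual) :
        H.heisSlice x t ∈ Submodule.span ℂ {s | ∃ p t, s = left (H.embB p) t} := by
      refine map_mem_of_surjective (e := H.dualT₁.toLinearMap) H.dualT₁.surjective _
        (fun p q => ?_) t
      exact Submodule.subset_span ⟨p, H.heis x q, rfl⟩
    suffices ⊤ ≤ (Submodule.span ℂ {s | ∃ p t, s = left (H.embB p) t}).comap (H.heis.flip b) from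
      this trivial
    rw [← H.span_act_eq_top, Submodule.span_le]
    rintro _ ⟨b', x, rfl⟩
    exact heisSlice_mem x (b' ⊗ₜ b)
  · refine map_mem_of_surjective H.dual_mul'_surjective (H.heis a) (fun x y => ?_) b
    exact Submodule.subset_span ⟨y, H.heis a x, rfl⟩

end Embeddings

variable {C : Type v} [NonUnitalRing C] [Module ℂ C] [IsScalarTower ℂ C C] [SMulCommClass ℂ C C]
variable {jA : A →ₙₐ[ℂ] Multiplier C} {jB : H.Dual →ₙₐ[ℂ] Multiplier C}

section Relations

@[simp] theorem productMap_heis (a : A) (b : H.Dual) :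
    H.productMap jA jB (H.heis a b) = jA a * jB b := rfl

theorem productMap_embALeft (a : A) (s : H.Heisenberg) :
    H.productMap jA jB (H.embALeft a s) = jA a * H.productMap jA jB s := by
  induction s using H.heis_induction with
  | h p b => simp [mul_assoc]
  | hadd s t hs ht => simp only [map_add, mul_add, hs, ht]

theorem heis_mul (a : A) (b : H.Dual) (s : H.Heisenberg) :
    H.heis a b * s = H.embALeft a (H.embBLeft b s) :=
  H.heis_ext fun x => by
    rw [heisAct_mul, heisAct_embALeft, heisAct_embBLeft, heisAct_heis]

theorem heisenbergRelations_iff (hC : IsNondegenerate C) (hA : IsNondegenerateHom jA) :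
    H.HeisenbergRelations jA jB ↔ ∀ b b' x, H.productMap jA jB (H.embBLeft b (H.heis x b')) =
      jB b * (jA x * jB b') := by
  have cancel_jA (m n : Multiplier C) (h : ∀ a, jA a * m = jA a * n) : m = n :=
    ext_left hC fun z => hA.eq_of_left hC fun a => by rw [← left_mul, h, left_mul]
  simp only [HeisenbergRelations, heis_mul, productMap_embALeft, mul_assoc]
  exact ⟨fun h b b' x => cancel_jA _ _ fun a => (h a x b b').symm,
    fun h a x b b' => by rw [h]⟩

theorem heisenbergRelations_emb : H.HeisenbergRelations H.embA H.embB := by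
  have productMap_eq_of (s : H.Heisenberg) : H.productMap H.embA H.embB s = ofHom _ s := by
    induction s using H.heis_induction with
    | h a b => exact H.embA_mul_embB a b
    | hadd s t hs ht => rw [map_add, map_add, hs, ht]
  intro a a' b b'
  rw [productMap_eq_of, map_mul, ofHom_apply, ofHom_apply, ← embA_mul_embB, ← embA_mul_embB]
  simp only [mul_assoc]

end Relations

section FirstFormula

theorem eval_slice_dualityLeft (ω : A →ₗ[ℂ] ℂ) (b : H.Dual) (a u : A) :
    H.eval (slice ω (H.dualityLeft (b ⊗ₜ a))) u = ω (H.act b u * a) := by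
  rw [← sliceAt_dualityLeft]
  exact apply_slice (H.eval.flip u) ω _

theorem slice_left_extend_duality_of_eval (hC : IsNondegenerate C) (hB : IsNondegenerateHom jB)
    (ω : A →ₗ[ℂ] ℂ) {b d : H.Dual} {c : A} (hd : ∀ u, H.eval d u = ω (H.act b u * c)) (z : C) :
    slice ω (left (extend (tensorHom jB (ofHom A)) H.duality) (left (jB b) z ⊗ₜ c)) =
      left (jB d) z := by
  have hγ := tensorHom_nondegenerate hB (ofHom_nondegenerate H.mul'_surjective)
  suffices ∃ d, (∀ u, H.eval d u = ω (H.act b u * c)) ∧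
      slice ω (left (extend (tensorHom jB (ofHom A)) H.duality) (left (jB b) z ⊗ₜ c)) =
        left (jB d) z by
    obtain ⟨d', hd', slice_eq⟩ := this
    rw [slice_eq, H.dual_ext fun u => (hd u).trans (hd' u).symm]
  clear hd
  obtain ⟨t, rfl⟩ := H.mul'_surjective c
  induction t with
  | zero => exact ⟨0, by simp⟩
  | add s t hs ht =>
    obtain ⟨d, hd, slice_s⟩ := hs
    obtain ⟨e, he, slice_t⟩ := ht
    refine ⟨d + e, by simp [mul_add, hd, he], ?_⟩
    simp only [map_add, TensorProduct.tmul_add, left_add, LinearMap.add_apply, slice_s, slice_t]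
  | tmul a x =>
    refine ⟨slice (ω ∘ₗ LinearMap.mulRight ℂ x) (H.dualityLeft (b ⊗ₜ a)), fun u => ?_, ?_⟩
    · simp [eval_slice_dualityLeft, mul_assoc]
    · rw [← slice_left_tensorHom_ofHom]
      exact congrArg (slice ω)
        (left_extend (hC.tensor H.nondegenerate) hγ H.duality (b ⊗ₜ a) (z ⊗ₜ x))

theorem slice_left_extend_duality (hC : IsNondegenerate C) (hB : IsNondegenerateHom jB)
    (z : C) (c : A) :
    slice H.φ (left (extend (tensorHom jB (ofHom A)) H.duality) (z ⊗ₜ c)) =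
      left (jB (H.toDual c)) z := by
  induction z using hB.induction with
  | zero => simp
  | add x y hx hy => simp only [TensorProduct.add_tmul, map_add, hx, hy]
  | act b z =>
    rw [← left_mul, ← map_mul]
    exact H.slice_left_extend_duality_of_eval hC hB H.φ (fun _ => rfl) z

theorem tmul_mul_extend_Δ (hC : IsNondegenerate C) (hA : IsNondegenerateHom jA) (a a' : A) :
    tmul (jA a') 1 * extend (tensorHom jA (ofHom A)) (H.Δ a) =
      tensorHom jA (ofHom A) (H.T₂ (a' ⊗ₜ a)) := by
  have hγ := tensorHom_nondegenerate hA (ofHom_nondegenerate H.mul'_surjective)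
  have hCA := hC.tensor H.nondegenerate
  refine hγ.eq_of_mul hCA fun p => ?_
  rw [mul_assoc, (extend_spec hCA hγ (H.Δ a) p).1, tmul_one_mul_tensorHom_ofHom, ← map_mul]
  exact congrArg (tensorHom jA (ofHom A)) (congrArg (left · p) (H.T₂_spec a' a)).symm

theorem slice_left_tensorHom_mul_extend_duality (hC : IsNondegenerate C)
    (hB : IsNondegenerateHom jB) (w : A ⊗[ℂ] A) (b : H.Dual) (z : C) (c : A) :
    slice H.φ (left (tensorHom jA (ofHom A) w)
      (left (extend (tensorHom jB (ofHom A)) H.duality) (left (jB b) z ⊗ₜ c))) =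
      left (H.productMap jA jB (H.heisMap (H.actMulₗ (H.toDual c ⊗ₜ b)) w)) z := by
  induction w with
  | zero => simp
  | add s t hs ht => simp only [map_add, left_add, LinearMap.add_apply, hs, ht]
  | tmul p q =>
    rw [tensorHom_tmul, left_tmul, slice_map, heisMap_tmul, productMap_heis, left_mul]
    refine congrArg (left (jA p)) (H.slice_left_extend_duality_of_eval hC hB _ (fun u => ?_) z)
    simp [mul_assoc]

theorem left_slice_left_Δ_mul_duality (hC : IsNondegenerate C) (hA : IsNondegenerateHom jA)
    (hB : IsNondegenerateHom jB) (a a' c : A) (b : H.Dual) (z : C) :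
    left (jA a') (slice H.φ (left (extend (tensorHom jA (ofHom A)) (H.Δ a) *
      extend (tensorHom jB (ofHom A)) H.duality) (left (jB b) z ⊗ₜ c))) =
      left (H.productMap jA jB (H.heis a' (H.toDual c) * H.heis a b)) z := by
  rw [heis_mul_heis]
  refine Eq.trans ?_ (H.slice_left_tensorHom_mul_extend_duality hC hB _ b z c)
  rw [← H.tmul_mul_extend_Δ hC hA, ← slice_rTensor]
  rfl

theorem slice_left_duality_mul_tmul (hC : IsNondegenerate C) (hB : IsNondegenerateHom jB)
    (a c : A) (z : C) :
    slice H.φ (left (extend (tensorHom jB (ofHom A)) H.duality * tmul (jA a) 1) (z ⊗ₜ c)) =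
      left (jB (H.toDual c) * jA a) z := by
  rw [left_mul, left_tmul, TensorProduct.map_tmul, left_one, H.slice_left_extend_duality hC hB,
    left_mul]

theorem multiplier_ext_slice (hC : IsNondegenerate C) {m n : Multiplier (C ⊗[ℂ] A)}
    (h : ∀ z c, slice H.φ (left m (z ⊗ₜ c)) = slice H.φ (left n (z ⊗ₜ c))) : m = n := by
  have hCA := hC.tensor H.nondegenerate
  have slice_eval_toDual (m : Multiplier (C ⊗[ℂ] A)) (z : C) (e c : A) :
      slice (H.eval (H.toDual c)) (left m (z ⊗ₜ e)) = slice H.φ (left m (z ⊗ₜ (e * c))) := by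
    have mul_right := left_right_comm hCA m (tmul 1 (of c)) (z ⊗ₜ e)
    rw [right_tmul, TensorProduct.map_tmul, right_one, right_of] at mul_right
    rw [mul_right]
    exact (slice_lTensor (LinearMap.mulRight ℂ c) H.φ _).symm
  refine ext_left hCA (LinearMap.congr_fun (TensorProduct.ext' fun z e => ?_))
  refine H.eq_of_slice_eval fun b => ?_
  obtain ⟨c, rfl⟩ := H.toDual_surjective b
  rw [slice_eval_toDual, slice_eval_toDual, h]

theorem firstFormula_iff (hC : IsNondegenerate C) (hA : IsNondegenerateHom jA)
    (hB : IsNondegenerateHom jB) :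
    H.FirstFormula jA jB H.duality ↔ H.HeisenbergRelations jA jB := by
  constructor
  · intro h a a' b b'
    obtain ⟨c, rfl⟩ := H.toDual_surjective b
    refine ext_left hC fun z => ?_
    rw [← H.left_slice_left_Δ_mul_duality hC hA hB, h, H.slice_left_duality_mul_tmul hC hB]
    simp only [left_mul]
  · intro h a
    refine H.multiplier_ext_slice hC fun z c => hA.eq_of_left hC fun a' => ?_
    induction z using hB.induction with
    | zero => simp
    | add x y hx hy => simp only [TensorProduct.add_tmul, map_add, hx, hy]
    | act b z =>
      rw [H.left_slice_left_Δ_mul_duality hC hA hB, ← h, H.slice_left_duality_mul_tmul hC hB]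
      simp only [left_mul]

end FirstFormula

section SecondFormula

theorem sliceAt_left_extend_duality (hC : IsNondegenerate C) (hA : IsNondegenerateHom jA)
    (b : H.Dual) (z : C) (u : A) :
    H.sliceAt u (left (extend (tensorHom (ofHom H.Dual) jA) H.duality) (b ⊗ₜ z)) =
      left (jA (H.act b u)) z := by
  have hγ := tensorHom_nondegenerate (ofHom_nondegenerate H.dual_mul'_surjective) hA
  induction z using hA.induction with
  | zero => simp
  | add x y hx hy => simp only [TensorProduct.tmul_add, map_add, hx, hy]
  | act a z =>
    obtain ⟨t, rfl⟩ := H.dual_mul'_surjective b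
    induction t with
    | zero => simp
    | add s t hs ht =>
      simp only [map_add, TensorProduct.add_tmul, LinearMap.add_apply, left_add, hs, ht]
    | tmul b b₀ =>
      have left_extend_mul := left_extend (H.dual_nondegenerate.tensor hC) hγ H.duality (b ⊗ₜ a)
        (b₀ ⊗ₜ z)
      rw [LinearMap.mul'_apply, act_mul_apply, ← left_mul, ← map_mul, ← sliceAt_dualityLeft]
      refine (congrArg (H.sliceAt u) left_extend_mul).trans ?_
      exact lslice_left_tensorHom_ofHom _ _ _ _ _

theorem sliceAt_left_duality_mul_tensorHom (hC : IsNondegenerate C) (hA : IsNondegenerateHom jA)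
    (t : H.Dual ⊗[ℂ] H.Dual) (b : H.Dual) (z : C) (u : A) :
    H.sliceAt u (left (extend (tensorHom (ofHom H.Dual) jA) H.duality)
      (left (tensorHom (ofHom H.Dual) jB t) (b ⊗ₜ z))) =
      left (H.productMap jA jB (H.heisSlice (H.act b u) t)) z := by
  induction t with
  | zero => simp
  | add s t hs ht => simp only [map_add, left_add, LinearMap.add_apply, hs, ht]
  | tmul β β' =>
    simp [H.sliceAt_left_extend_duality hC hA, act_mul_apply]

theorem sliceAt_left_duality_mul_coproduct (hC : IsNondegenerate C) (hA : IsNondegenerateHom jA)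
    (hB : IsNondegenerateHom jB) (b b₁ b₂ : H.Dual) (z : C) (u : A) :
    H.sliceAt u (left (extend (tensorHom (ofHom H.Dual) jA) H.duality *
      extend (tensorHom (ofHom H.Dual) jB) (H.coproduct b)) (b₁ ⊗ₜ left (jB b₂) z)) =
      left (H.productMap jA jB (H.embBLeft b (H.heis (H.act b₁ u) b₂))) z := by
  have hγ := tensorHom_nondegenerate (ofHom_nondegenerate H.dual_mul'_surjective) hB
  obtain ⟨t, rfl⟩ := H.dual_mul'_surjective b₁
  induction t with
  | zero => simp
  | add s t hs ht =>
    simp only [map_add, TensorProduct.add_tmul, LinearMap.add_apply, left_add, hs, ht]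
  | tmul b₁ b₀ =>
    have left_extend_mul := left_extend (H.dual_nondegenerate.tensor hC) hγ (H.coproduct b)
      (b₁ ⊗ₜ b₂) (b₀ ⊗ₜ z)
    rw [LinearMap.mul'_apply, left_mul, embBLeft_heis, act_mul_apply,
      ← heisSlice_rTensor_mulRight, ← coproductLeft_tmul,
      ← H.sliceAt_left_duality_mul_tensorHom hC hA]
    exact congrArg (fun s => H.sliceAt u (left _ s)) left_extend_mul

theorem sliceAt_left_tmul_mul_duality (hC : IsNondegenerate C) (hA : IsNondegenerateHom jA)
    (b b₁ : H.Dual) (z : C) (u : A) :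
    H.sliceAt u (left (tmul 1 (jB b) * extend (tensorHom (ofHom H.Dual) jA) H.duality)
      (b₁ ⊗ₜ z)) = left (jB b * jA (H.act b₁ u)) z := by
  rw [left_mul, left_mul, ← H.sliceAt_left_extend_duality hC hA]
  exact lslice_lTensor _ _ _

theorem secondFormula_iff (hC : IsNondegenerate C) (hA : IsNondegenerateHom jA)
    (hB : IsNondegenerateHom jB) :
    H.SecondFormula jA jB H.coproduct H.duality ↔ H.HeisenbergRelations jA jB := by
  rw [H.heisenbergRelations_iff hC hA]
  constructor
  · intro h b b' x
    suffices H.productMap jA jB ∘ₗ H.embBLeft b ∘ₗ H.heis.flip b' =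
        LinearMap.mulLeft ℂ (jB b) ∘ₗ H.productMap jA jB ∘ₗ H.heis.flip b' from
      LinearMap.congr_fun this x
    refine LinearMap.ext_on H.span_act_eq_top ?_
    rintro _ ⟨b₁, u, rfl⟩
    refine ext_left hC fun z => ?_
    refine (H.sliceAt_left_duality_mul_coproduct hC hA hB b b₁ b' z u).symm.trans ?_
    rw [h, H.sliceAt_left_tmul_mul_duality hC hA]
    rfl
  · intro h b
    refine ext_left (H.dual_nondegenerate.tensor hC) <| LinearMap.congr_fun <|
      TensorProduct.ext' fun b₁ z => H.eq_of_sliceAt fun u => ?_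
    induction z using hB.induction with
    | zero => simp
    | add x y hx hy => simp only [TensorProduct.tmul_add, map_add, hx, hy]
    | act b' z =>
      rw [H.sliceAt_left_duality_mul_coproduct hC hA hB, h, H.sliceAt_left_tmul_mul_duality hC hA]
      simp only [left_mul]

end SecondFormula

end AlgebraicQuantumGroup

end MultiplierHopf

end

theorem proposition3p15 {A : Type*} [NonUnitalRing A] [Module ℂ A] [IsScalarTower ℂ A A]
    [SMulCommClass ℂ A A] (H : MultiplierHopf.AlgebraicQuantumGroup A) :
    -- the algebras `B` and `AB` are non-degenerate
    MultiplierHopf.IsNondegenerate H.Dual ∧ MultiplierHopf.IsNondegenerate H.Heisenberg ∧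
    -- the coproduct of `B`, the duality `V` and the embeddings of `A` and `B` in `M(AB)`
    (∃! ΔB, H.IsDualCoproduct ΔB) ∧
    (∃! V, H.IsDuality V) ∧
    (∃! j : (A →ₙₐ[ℂ] MultiplierHopf.Multiplier H.Heisenberg) ×
        (H.Dual →ₙₐ[ℂ] MultiplierHopf.Multiplier H.Heisenberg),
      H.IsHeisenbergEmbedding j.1 j.2) ∧
    ∀ ΔB, H.IsDualCoproduct ΔB → ∀ V, H.IsDuality V →
      -- the two formulas in `M(AB ⊗ A)` and in `M(B ⊗ AB)`
      (∀ jA jB, H.IsHeisenbergEmbedding jA jB →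
        MultiplierHopf.IsNondegenerateHom jA ∧ MultiplierHopf.IsNondegenerateHom jB ∧
        (∀ a b, jA a * jB b = MultiplierHopf.Multiplier.of (H.heis a b)) ∧
        H.FirstFormula jA jB V ∧ H.SecondFormula jA jB ΔB V) ∧
      -- the equivalence with the Heisenberg commutation relations
      (∀ (C : Type*) [NonUnitalRing C] [Module ℂ C] [IsScalarTower ℂ C C] [SMulCommClass ℂ C C]
        (jA : A →ₙₐ[ℂ] MultiplierHopf.Multiplier C)
        (jB : H.Dual →ₙₐ[ℂ] MultiplierHopf.Multiplier C),
        MultiplierHopf.IsNondegenerate C →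
        MultiplierHopf.IsNondegenerateHom jA → MultiplierHopf.IsNondegenerateHom jB →
        (H.FirstFormula jA jB V ↔ H.HeisenbergRelations jA jB) ∧
        (H.SecondFormula jA jB ΔB V ↔ H.HeisenbergRelations jA jB)) := by
  refine ⟨H.dual_nondegenerate, H.heisenberg_nondegenerate,
    ⟨H.coproduct, (H.isDualCoproduct_iff _).2 rfl, fun _ h => (H.isDualCoproduct_iff _).1 h⟩,
    ⟨H.duality, (H.isDuality_iff _).2 rfl, fun _ h => (H.isDuality_iff _).1 h⟩,
    ⟨(H.embA, H.embB), (H.isHeisenbergEmbedding_iff _ _).2 ⟨rfl, rfl⟩,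
      fun _ h => Prod.ext_iff.2 ((H.isHeisenbergEmbedding_iff _ _).1 h)⟩, ?_⟩
  intro ΔB hΔB V hV
  obtain rfl := (H.isDualCoproduct_iff _).1 hΔB
  obtain rfl := (H.isDuality_iff _).1 hV
  refine ⟨fun jA jB hj => ?_, fun C _ _ _ _ jA jB hC hA hB =>
    ⟨H.firstFormula_iff hC hA hB, H.secondFormula_iff hC hA hB⟩⟩
  obtain ⟨rfl, rfl⟩ := (H.isHeisenbergEmbedding_iff _ _).1 hj
  exact ⟨H.embA_nondegenerate, H.embB_nondegenerate, H.embA_mul_embB,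
    (H.firstFormula_iff H.heisenberg_nondegenerate H.embA_nondegenerate
      H.embB_nondegenerate).2 H.heisenbergRelations_emb,
    (H.secondFormula_iff H.heisenberg_nondegenerate H.embA_nondegenerate
      H.embB_nondegenerate).2 H.heisenbergRelations_emb⟩
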